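/- Let $q\ge 0$ be an integer and $f\in\mathbb{R}^q$. A convex set $B\subseteq\mathbb{R}^q$ is called lattice-free if its interior contains no point of $\mathbb{Z}^q$, and a maximal lattice-free convex set if moreover it is contained properly in no lattice-free convex set. For a family of vectors $(r_i)_{i\in I}$ in $\mathbb{R}^q$ (finite or infinite) let $R_f((r_i)_{i\in I})$ be the set of all finitely supported $s=(s_i)_{i\in I}\in\mathbb{R}^I$ with $s_i\ge 0$ for all $i$ and $f+\sum_{i\in I}s_ir_i\in\mathbb{Z}^q$; write $R_f(\mathbb{R}^q)$ for the case of the family of all vectors $r\in\mathbb{R}^q$. An inequality $\sum_i\psi_is_i\ge 1$ is valid for a set $X$ of finitely supported vectors if every $s\in X$ satisfies it, and it is extreme for $X$ if it is valid for $X$ and there are no two distinct functions $\psi_1\ne\psi_2$ on $I$ such that $\psi\ge\frac12(\psi_1+\psi_2)$ and the inequalities $\sum_i(\psi_1)_is_i\ge1$ and $\sum_i(\psi_2)_is_i\ge 1$ are both valid for $X$. Theorem. Let $B$ be a maximal lattice-free convex set in $\mathbb{R}^q$ with $f$ in its interior. Let $L=\mathrm{lin}(B)=\{r\in\mathbb{R}^q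 : x+tr\in B\text{ for all }x\in B,\ t\in\mathbb{R}\}$ be its lineality space and let $P=B\cap(f+L^\perp)$. Then $B=P+L$, the linear space $L$ is rational (generated by its integral points), and $P$ is a polytope. There are $a_1,\dots,a_t\in\mathbb{R}^q$ with $t\ge1$ and $B=\{x : a_i\cdot(x-f)\le 1,\ i=1,\dots,t\}$, and the function $\psi_B(r)=\max_{i=1,\dots,t}a_i\cdot r$ does not depend on the choice of the $a_i$. Let $v^1,\dots,v^k$ be the (distinct) vertices of $P$, let $r^j=v^j-f$ for $j=1,\dots,k$, and let $r^{k+1},\dots,r^{k+h}$ be a basis of $L$ consisting of vectors with rational coordinates. Then the inequality $\sum_{r\in\mathbb{R}^q}\psi_B(r)s_r\ge 1$ is extreme for $R_f(\mathbb{R}^q)$ if and only if the inequality $\sum_{j=1}^k s_j\ge 1$ is extreme for $\mathrm{conv}(R_f(r^1,\dots,r^{k+h}))$. -/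

import Mathlib

open scoped Pointwise

namespace CornerRelaxation

/-- The space `ℝ^q` with its Euclidean norm and inner product. -/
abbrev E (q : ℕ) : Type := EuclideanSpace ℝ (Fin q)

/-- The set `ℤ^q` of integral points of `ℝ^q`. -/
def integralPoints (q : ℕ) : Set (E q) := {x | ∀ i, ∃ z : ℤ, x i = (z : ℝ)}

/-- A lattice-free convex set in `ℝ^q`: a convex set with no integral point in its interior. -/
def IsLatticeFreeConvex {q : ℕ} (B : Set (E q)) : Prop :=
  Convex ℝ B ∧ ∀ x ∈ interior B, x ∉ integralPoints q

/-- A maximal lattice-free convex set in `ℝ^q` (maximal for inclusion). -/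
def IsMaximalLatticeFreeConvex {q : ℕ} (B : Set (E q)) : Prop :=
  Maximal IsLatticeFreeConvex B

/-- The lineality space `lin(B)`: the directions `r` such that `B` contains the whole line
`x + ℝ r` for every `x ∈ B`. -/
def lin {q : ℕ} (B : Set (E q)) : Submodule ℝ (E q) where
  carrier := {r | ∀ x ∈ B, ∀ t : ℝ, x + t • r ∈ B}
  zero_mem' := by
    intro x hx t
    simpa using hx
  add_mem' := by
    intro a b ha hb x hx t
    have h := hb _ (ha x hx t) t
    simpa [smul_add, add_assoc] using h
  smul_mem' := by
    intro c a ha x hx t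
    have h := ha x hx (t * c)
    simpa [mul_smul] using h

/-- The section `B ∩ (f + L^⊥)`, where `L = lin(B)`. -/
def orthSection {q : ℕ} (f : E q) (B : Set (E q)) : Set (E q) :=
  {x | x ∈ B ∧ x - f ∈ (lin B)ᗮ}

/-- A linear subspace is rational if it is generated by its integral points. -/
def IsRationalSpace {q : ℕ} (L : Submodule ℝ (E q)) : Prop :=
  Submodule.span ℝ {x : E q | x ∈ L ∧ x ∈ integralPoints q} = L

/-- A vector with rational coordinates. -/
def IsRationalVector {q : ℕ} (x : E q) : Prop := ∀ i, ∃ c : ℚ, x i = (c : ℝ)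

/-- A polytope: the convex hull of finitely many points. -/
def IsPolytope {q : ℕ} (P : Set (E q)) : Prop :=
  ∃ F : Set (E q), F.Finite ∧ P = convexHull ℝ F

/-- `ψ` is the function `ψ_B`: for some `a_1, …, a_t` with
`B = {x | a_i (x - f) ≤ 1, i = 1, …, t}`, one has `ψ r = max_i a_i r` for every `r`. -/
def IsPsi {q : ℕ} (f : E q) (B : Set (E q)) (ψ : E q → ℝ) : Prop :=
  ∃ (t : ℕ) (a : Fin t → E q),
    B = {x | ∀ i, inner ℝ (a i) (x - f) ≤ 1} ∧
      ∀ r, IsGreatest (Set.range fun i => inner ℝ (a i) r) (ψ r)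

/-- The set `R_f` for a family `(r_i)` of vectors, finite or not: the finitely supported
`s ≥ 0` with `f + ∑ i, s_i r_i` integral. -/
def Rf {q : ℕ} {ι : Type} (f : E q) (r : ι → E q) : Set (ι →₀ ℝ) :=
  {s | f + s.sum (fun i c => c • r i) ∈ integralPoints q ∧ ∀ i, 0 ≤ s i}

/-- `R_f(ℝ^q)`: the set `R_f` for the family of all vectors of `ℝ^q`. -/
def RfAll {q : ℕ} (f : E q) : Set (E q →₀ ℝ) := Rf f (fun r : E q => r)

/-- The inequality `∑ i, ψ_i s_i ≥ 1` is valid for `X`. -/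
def IsValid {ι : Type} (X : Set (ι →₀ ℝ)) (ψ : ι → ℝ) : Prop :=
  ∀ s ∈ X, 1 ≤ s.sum (fun i c => ψ i * c)

/-- The inequality `∑ i, ψ_i s_i ≥ 1` is extreme for `X` (in the sense of Gomory and Johnson):
it is valid, and there are no distinct `ψ₁`, `ψ₂` giving valid inequalities
with `ψ ≥ (ψ₁ + ψ₂) / 2`. -/
def IsExtreme {ι : Type} (X : Set (ι →₀ ℝ)) (ψ : ι → ℝ) : Prop :=
  IsValid X ψ ∧
    ¬ ∃ ψ₁ ψ₂ : ι → ℝ, ψ₁ ≠ ψ₂ ∧ IsValid X ψ₁ ∧ IsValid X ψ₂ ∧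
      ∀ i, (1 / 2 : ℝ) * (ψ₁ i + ψ₂ i) ≤ ψ i

end CornerRelaxation

namespace CornerRelaxation

open Filter Topology

variable {q : ℕ}

/-! ### Integral points and Diophantine approximation along a ray. -/

section Integral

/-! Geometry. Write `L = lin B`. If `int B + ℝ u` misses the lattice, maximality of `B` forces `u ∈
L`. By simultaneous approximation this applies to every recession direction, so `B` is bounded
modulo `L`. It also applies to any limit of directions of ever shorter projections of lattice points
to `Lᗮ`, so that projection is discrete. Hence `L` is rational, and finitely many halfspaces, each
cutting off one projected lattice point, already define `B`.

Extremality. The function `ψ` is sublinear with unit level set `B - f`, and maximality of `B` makes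
it minimal among sublinear functions that are at least `1` on `ℤ^q - f` (`IsSublinear.eq_of_le`). A
valid inequality is turned into such a function by `sublinearHull`, the cheapest price of a vector.
So two valid inequalities with mean below `ψ` are themselves sublinear with mean exactly `ψ`.

The two extremality statements are then compared through contrapositives. Restricting `ψ₁ ≠ ψ₂` to
the vertex directions and the basis of `L` keeps them distinct: both are nonpositive on `L`, and
modulo `L` every vector is a nonnegative combination of vertex directions on which `ψ` is additive
(`IsPsi.exists_combination`). Conversely, `φ₁ ≠ φ₂` on the finite family vanish on the basis of `L`,
and their hulls modulo `L` have mean `ψ` and agree with them at the vertices. -/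

lemma integralPoints_zero : (0 : E q) ∈ integralPoints q := fun _ => ⟨0, by simp⟩

lemma integralPoints_add {x y : E q} (hx : x ∈ integralPoints q) (hy : y ∈ integralPoints q) :
    x + y ∈ integralPoints q := fun i => by
  obtain ⟨a, ha⟩ := hx i
  obtain ⟨b, hb⟩ := hy i
  exact ⟨a + b, by simp [ha, hb]⟩

lemma integralPoints_zsmul {x : E q} (hx : x ∈ integralPoints q) (m : ℤ) :
    (m : ℝ) • x ∈ integralPoints q := fun i => by
  obtain ⟨a, ha⟩ := hx i
  exact ⟨m * a, by simp [ha]⟩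

lemma integralPoints_sub {x y : E q} (hx : x ∈ integralPoints q) (hy : y ∈ integralPoints q) :
    x - y ∈ integralPoints q := by
  have := integralPoints_add hx (integralPoints_zsmul hy (-1))
  simpa [sub_eq_add_neg] using this

lemma integralPoints_sum {ι : Type*} (s : Finset ι) {x : ι → E q}
    (hx : ∀ i ∈ s, x i ∈ integralPoints q) : ∑ i ∈ s, x i ∈ integralPoints q :=
  Finset.sum_induction _ (· ∈ integralPoints q) (fun _ _ => integralPoints_add)
    integralPoints_zero hx

/-- The coordinatewise integer part. -/
noncomputable def floorPoint (x : E q) : E q := WithLp.toLp 2 fun i => (⌊x i⌋ : ℝ)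

lemma floorPoint_mem (x : E q) : floorPoint x ∈ integralPoints q := fun i => ⟨⌊x i⌋, rfl⟩

lemma norm_sub_floorPoint_le (x : E q) : ‖x - floorPoint x‖ ≤ √q := by
  rw [EuclideanSpace.norm_eq]
  apply Real.sqrt_le_sqrt
  calc ∑ i, ‖(x - floorPoint x) i‖ ^ 2 ≤ ∑ _i : Fin q, (1 : ℝ) := by
        refine Finset.sum_le_sum fun i _ => ?_
        have h1 : (x - floorPoint x) i = Int.fract (x i) := rfl
        rw [h1, Real.norm_of_nonneg (Int.fract_nonneg _)]
        exact pow_le_one₀ (Int.fract_nonneg _) (Int.fract_lt_one _).le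
    _ = q := by simp

/-- A bounded sequence has two terms, with indices arbitrarily far apart, that are close. -/
lemma exists_close_of_bounded {x : ℕ → E q} {R : ℝ} (hx : ∀ n, ‖x n‖ ≤ R) {ε : ℝ} (hε : 0 < ε)
    (N : ℕ) : ∃ m n, m + N ≤ n ∧ m < n ∧ ‖x n - x m‖ < ε := by
  obtain ⟨a, -, φ, hφ, hlim⟩ := (isCompact_closedBall (0 : E q) R).tendsto_subseq
    (x := x) (fun n => by simpa using hx n)
  obtain ⟨M, hM⟩ := Metric.cauchySeq_iff.1 hlim.cauchySeq ε hε
  -- Since `φ n ≥ n`, this shift puts the second index beyond `φ M + N`.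
  refine ⟨φ M, φ (M + (φ M + N + 1)), ?_, hφ (by omega), ?_⟩
  · have := hφ.id_le (M + (φ M + N + 1))
    simp only [id] at this
    omega
  · have := hM (M + (φ M + N + 1)) (by omega) M le_rfl
    rwa [dist_eq_norm] at this

/-- Simultaneous Diophantine approximation along a ray. -/
lemma exists_integral_near_ray (r : E q) (T : ℝ) {ε : ℝ} (hε : 0 < ε) :
    ∃ s : ℝ, T ≤ s ∧ 0 ≤ s ∧ ∃ w ∈ integralPoints q, ‖w - s • r‖ < ε := by
  obtain ⟨N, hN⟩ := exists_nat_ge T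
  obtain ⟨m, n, hmn, hlt, hd⟩ := exists_close_of_bounded
    (x := fun n : ℕ => (n : ℝ) • r - floorPoint ((n : ℝ) • r))
    (fun n => norm_sub_floorPoint_le _) hε N
  have hmn' : (m : ℝ) + N ≤ n := by exact_mod_cast hmn
  have hlt' : (m : ℝ) < n := by exact_mod_cast hlt
  refine ⟨n - m, by linarith, by linarith,
    floorPoint ((n : ℝ) • r) - floorPoint ((m : ℝ) • r),
    integralPoints_sub (floorPoint_mem _) (floorPoint_mem _), ?_⟩
  rw [← norm_neg]
  refine lt_of_eq_of_lt (congrArg norm ?_) hd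
  module

end Integral

/-! ### Orthogonal projection along a subspace. -/

section Projection

variable {L : Submodule ℝ (E q)}

lemma sub_orthogonal_starProjection_mem (L : Submodule ℝ (E q)) (x : E q) :
    x - Lᗮ.starProjection x ∈ L := by
  have := Lᗮ.sub_starProjection_mem_orthogonal x
  rwa [Submodule.orthogonal_orthogonal] at this

lemma orthogonal_starProjection_mem (L : Submodule ℝ (E q)) (x : E q) :
    Lᗮ.starProjection x ∈ Lᗮ := Submodule.starProjection_apply_mem _ _

lemma orthogonal_starProjection_eq_zero_iff {x : E q} : Lᗮ.starProjection x = 0 ↔ x ∈ L := by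
  rw [Submodule.starProjection_apply_eq_zero_iff, Submodule.orthogonal_orthogonal]

end Projection

/-! ### Invariance of a set under its lineality space. -/

section Lineality

variable {B : Set (E q)}

lemma add_mem_of_mem_lin {x l : E q} (hx : x ∈ B) (hl : l ∈ lin B) : x + l ∈ B := by
  simpa using hl x hx 1

lemma add_mem_interior_of_mem_lin {x l : E q} (hx : x ∈ interior B) (hl : l ∈ lin B) :
    x + l ∈ interior B := by
  obtain ⟨δ, hδ, hb⟩ := Metric.isOpen_iff.1 isOpen_interior x hx
  refine mem_interior.2 ⟨Metric.ball (x + l) δ, fun y hy => ?_, Metric.isOpen_ball,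
    Metric.mem_ball_self hδ⟩
  have h1 : y - l ∈ B := interior_subset (hb (by
    rw [Metric.mem_ball, dist_eq_norm] at hy ⊢
    refine lt_of_eq_of_lt (congrArg norm ?_) hy
    module))
  simpa using add_mem_of_mem_lin h1 hl

lemma mem_iff_of_sub_mem_lin {x y : E q} (h : x - y ∈ lin B) : x ∈ B ↔ y ∈ B := by
  constructor
  · intro hx
    have := add_mem_of_mem_lin hx ((lin B).neg_mem h)
    simpa using this
  · intro hy
    have := add_mem_of_mem_lin hy h
    simpa using this

end Lineality

/-! ### Maximal lattice-free sets: recession directions, discreteness and rationality. -/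

section Maximal

variable {B : Set (E q)} {f : E q}

lemma IsMaximalLatticeFreeConvex.convex (hB : IsMaximalLatticeFreeConvex B) : Convex ℝ B :=
  hB.prop.1

lemma IsMaximalLatticeFreeConvex.eq_of_subset (hB : IsMaximalLatticeFreeConvex B) {C : Set (E q)}
    (hC : Convex ℝ C) (hfree : ∀ x ∈ interior C, x ∉ integralPoints q) (h : B ⊆ C) : B = C :=
  Maximal.eq_of_subset hB ⟨hC, hfree⟩ h

lemma IsMaximalLatticeFreeConvex.isClosed (hB : IsMaximalLatticeFreeConvex B)
    (hf : f ∈ interior B) : IsClosed B := by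
  have h : B = closure B := hB.eq_of_subset hB.convex.closure (by
    rw [hB.convex.interior_closure_eq_interior_of_nonempty_interior ⟨f, hf⟩]
    exact hB.prop.2) subset_closure
  rw [h]
  exact isClosed_closure

lemma IsMaximalLatticeFreeConvex.closure_interior (hB : IsMaximalLatticeFreeConvex B)
    (hf : f ∈ interior B) : closure (interior B) = B := by
  rw [hB.convex.closure_interior_eq_closure_of_nonempty_interior ⟨f, hf⟩,
    (hB.isClosed hf).closure_eq]

/-- If `int B + ℝ u` is lattice-free, then `u` is a lineality direction. -/
lemma IsMaximalLatticeFreeConvex.mem_lin_of_forall_notMem (hB : IsMaximalLatticeFreeConvex B)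
    (hf : f ∈ interior B) {u : E q}
    (hu : ∀ x ∈ interior B, ∀ t : ℝ, x + t • u ∉ integralPoints q) : u ∈ lin B := by
  set C : Set (E q) := interior B + (Submodule.span ℝ {u} : Set (E q)) with hC
  have hCopen : IsOpen C := isOpen_interior.add_right
  have hCconv : Convex ℝ C := hB.convex.interior.add (Submodule.convex _)
  have hBC : interior B ⊆ C := fun x hx => ⟨x, hx, 0, by simp, by simp⟩
  have hne : (interior C).Nonempty := ⟨f, by rw [hCopen.interior_eq]; exact hBC hf⟩
  have hBeq : B = closure C := by
    refine hB.eq_of_subset hCconv.closure ?_ ?_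
    · rw [hCconv.interior_closure_eq_interior_of_nonempty_interior hne, hCopen.interior_eq]
      rintro _ ⟨x, hx, y, hy, rfl⟩
      obtain ⟨t, rfl⟩ := Submodule.mem_span_singleton.1 hy
      exact hu x hx t
    · rw [← hB.closure_interior hf]
      exact closure_mono hBC
  intro x hx t
  rw [hBeq] at hx ⊢
  refine map_mem_closure (f := fun y => y + t • u) (by fun_prop) hx ?_
  rintro _ ⟨y, hy, w, hw, rfl⟩
  refine ⟨y, hy, w + t • u, ?_, by simp [add_assoc]⟩
  exact Submodule.add_mem _ hw (Submodule.smul_mem _ _ (Submodule.mem_span_singleton_self u))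

/-- A closed convex set that contains one half-line contains all its translates. -/
lemma add_smul_mem_of_ray (hcl : IsClosed B) (hconv : Convex ℝ B) {r : E q}
    (hr : ∀ t : ℝ, 0 ≤ t → f + t • r ∈ B) {y : E q} (hy : y ∈ B) {s : ℝ} (hs : 0 ≤ s) :
    y + s • r ∈ B := by
  -- Weight `1 / (n + 1)` on the far point `f + s (n + 1) r` of the ray contributes exactly `s r`,
  -- while its share of `f` tends to zero.
  have hlim : Tendsto (fun n : ℕ => (1 - (1 / ((n : ℝ) + 1))) • y
      + (1 / ((n : ℝ) + 1)) • f + s • r) atTop (𝓝 ((1 - (0 : ℝ)) • y + (0 : ℝ) • f + s • r)) := by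
    have h0 := tendsto_one_div_add_atTop_nhds_zero_nat (𝕜 := ℝ)
    exact (((tendsto_const_nhds.sub h0).smul_const y).add (h0.smul_const f)).add_const _
  have : (1 - (0 : ℝ)) • y + (0 : ℝ) • f + s • r = y + s • r := by module
  rw [this] at hlim
  refine hcl.mem_of_tendsto hlim (Eventually.of_forall fun n => ?_)
  have hn : (0 : ℝ) < (n : ℝ) + 1 := by positivity
  have h1 : (1 : ℝ) / (n + 1) ≤ 1 := by
    rw [div_le_one hn]
    linarith [(Nat.cast_nonneg n : (0 : ℝ) ≤ n)]
  have := hconv hy (hr (s * (n + 1)) (by positivity)) (sub_nonneg.2 h1)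
    (by positivity : (0 : ℝ) ≤ 1 / ((n : ℝ) + 1)) (by ring)
  convert this using 1
  rw [smul_add, smul_smul, ← add_assoc]
  congr 2
  field_simp

/-- The recession cone of a maximal lattice-free convex set with interior is its
lineality space. -/
lemma IsMaximalLatticeFreeConvex.mem_lin_of_ray (hB : IsMaximalLatticeFreeConvex B)
    (hf : f ∈ interior B) {r : E q} (hr : ∀ t : ℝ, 0 ≤ t → f + t • r ∈ B) : r ∈ lin B := by
  refine hB.mem_lin_of_forall_notMem hf fun x hx t hz => ?_
  obtain ⟨δ, hδ, hb⟩ := Metric.isOpen_iff.1 isOpen_interior x hx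
  obtain ⟨s, hs, hs0, w, hw, hws⟩ := exists_integral_near_ray r (-t) hδ
  -- If `x + t r` were integral, adding `w ≈ s r` would give a lattice point near `x + (t + s) r`
  -- with `t + s ≥ 0`, hence interior to `B`.
  refine hB.prop.2 (x + t • r + w) ?_ (integralPoints_add hz hw)
  refine mem_interior.2 ⟨Metric.ball (x + (t + s) • r) δ, fun y hy => ?_, Metric.isOpen_ball, ?_⟩
  · have h1 : y - (t + s) • r ∈ B := interior_subset (hb (by
      rw [Metric.mem_ball, dist_eq_norm] at hy ⊢
      refine lt_of_eq_of_lt (congrArg norm ?_) hy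
      module))
    have := add_smul_mem_of_ray (hB.isClosed hf) hB.convex hr h1
      (by linarith : 0 ≤ t + s)
    simpa using this
  · rw [Metric.mem_ball, dist_eq_norm]
    refine lt_of_eq_of_lt (congrArg norm ?_) hws
    module

/-- The projection of the integral lattice along the lineality space has no short vectors. -/
lemma IsMaximalLatticeFreeConvex.exists_short_bound (hB : IsMaximalLatticeFreeConvex B)
    (hf : f ∈ interior B) : ∃ ε > 0, ∀ z ∈ integralPoints q,
      ‖(lin B)ᗮ.starProjection z‖ < ε → (lin B)ᗮ.starProjection z = 0 := by
  set p := (lin B)ᗮ.starProjection with hp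
  by_contra! hcon
  choose z hz hzlt hzne using fun n : ℕ =>
    hcon (1 / ((n : ℝ) + 1)) (by positivity)
  have hpos : ∀ n, 0 < ‖p (z n)‖ := fun n => norm_pos_iff.2 (hzne n)
  obtain ⟨u, hu, φ, hφ, hlim⟩ := (isCompact_sphere (0 : E q) 1).tendsto_subseq
    (x := fun n => ‖p (z n)‖⁻¹ • p (z n)) (fun n => by
      simp [norm_smul, (hpos n).ne'])
  have hz0 : Tendsto (fun n => ‖p (z (φ n))‖) atTop (𝓝 0) :=
    (squeeze_zero (fun n => (hpos n).le) (fun n => (hzlt n).le)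
      tendsto_one_div_add_atTop_nhds_zero_nat).comp hφ.tendsto_atTop
  have huperp : u ∈ (lin B)ᗮ :=
    (Submodule.isClosed_orthogonal _).mem_of_tendsto hlim (Eventually.of_forall fun n =>
      Submodule.smul_mem _ _ (orthogonal_starProjection_mem _ _))
  have hulin : u ∈ lin B := by
    refine hB.mem_lin_of_forall_notMem hf fun x hx t hxt => ?_
    obtain ⟨δ, hδ, hb⟩ := Metric.isOpen_iff.1 isOpen_interior x hx
    have hsmall : Tendsto (fun n => ‖p (z (φ n))‖ +
        |t| * ‖‖p (z (φ n))‖⁻¹ • p (z (φ n)) - u‖) atTop (𝓝 (0 + |t| * 0)) := by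
      refine hz0.add (Tendsto.const_mul _ ?_)
      have := (hlim.sub_const u).norm
      simpa using this
    rw [mul_zero, add_zero] at hsmall
    obtain ⟨n, hn⟩ := (hsmall.eventually (gt_mem_nhds hδ)).exists
    set y := z (φ n) with hy
    set d := ‖p y‖ with hd
    have hd0 : 0 < d := hpos _
    -- A multiple of the short vector `p y`, almost parallel to `u`, approximates `t u`: the error
    -- is at most `d` from rounding plus `|t|` times the error in direction.
    set m : ℤ := round (t / d) with hm
    have hmd : |(m : ℝ) * d - t| ≤ d := by
      have h1 := abs_sub_round (t / d)
      have h2 : (m : ℝ) * d - t = -((t / d - m) * d) := by field_simp; ring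
      rw [h2, abs_neg, abs_mul, abs_of_pos hd0]
      nlinarith
    have hdist : ‖(m : ℝ) • p y - t • u‖ < δ := by
      have h1 : (m : ℝ) • p y - t • u = ((m : ℝ) * d - t) • (d⁻¹ • p y)
          + t • (d⁻¹ • p y - u) := by
        have : (m : ℝ) • p y = ((m : ℝ) * d) • (d⁻¹ • p y) := by
          rw [smul_smul]
          congr 1
          field_simp
        rw [this]
        module
      rw [h1]
      refine (norm_add_le _ _).trans_lt (lt_of_le_of_lt ?_ hn)
      rw [norm_smul, norm_smul _ (d⁻¹ • p y - u), norm_smul, norm_inv, norm_norm, ← hd,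
        inv_mul_cancel₀ hd0.ne', mul_one]
      simpa using hmd
    refine hB.prop.2 (x + t • u - (m : ℝ) • y) ?_
      (integralPoints_sub hxt (integralPoints_zsmul (hz _) m))
    have h1 : x + t • u - (m : ℝ) • p y ∈ interior B := hb (by
      rw [Metric.mem_ball, dist_eq_norm, ← norm_neg]
      refine lt_of_eq_of_lt (congrArg norm ?_) hdist
      module)
    have h2 := add_mem_interior_of_mem_lin h1
      (Submodule.smul_mem _ (-(m : ℝ)) (sub_orthogonal_starProjection_mem (lin B) y))
    convert h2 using 1
    rw [← hp]
    module
  have : u = 0 := by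
    have := Submodule.inner_right_of_mem_orthogonal hulin huperp
    exact inner_self_eq_zero.1 this
  simp [this] at hu

/-- Only finitely many projections of integral points lie in a given ball. -/
lemma IsMaximalLatticeFreeConvex.finite_projections (hB : IsMaximalLatticeFreeConvex B)
    (hf : f ∈ interior B) (R : ℝ) :
    ((lin B)ᗮ.starProjection '' integralPoints q ∩ {x | ‖x‖ ≤ R}).Finite := by
  obtain ⟨ε, hε, hshort⟩ := hB.exists_short_bound hf
  by_contra hinf
  have hinf : Set.Infinite _ := hinf
  set e := hinf.natEmbedding with he
  obtain ⟨m, n, -, hmn, hd⟩ := exists_close_of_bounded (x := fun n => (e n : E q))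
    (fun n => (e n).2.2) hε 0
  obtain ⟨a, ha, hae⟩ := (e n).2.1
  obtain ⟨b, hb, hbe⟩ := (e m).2.1
  rw [← hae, ← hbe, ← map_sub] at hd
  have := hshort _ (integralPoints_sub ha hb) hd
  rw [map_sub, hae, hbe, sub_eq_zero] at this
  exact hmn.ne' (e.injective (Subtype.ext this))

/-- Modulo its lineality space, `B` is bounded. -/
lemma IsMaximalLatticeFreeConvex.exists_projection_bound (hB : IsMaximalLatticeFreeConvex B)
    (hf : f ∈ interior B) :
    ∃ R > 0, ∀ x ∈ B, ‖(lin B)ᗮ.starProjection (x - f)‖ ≤ R := by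
  set p := (lin B)ᗮ.starProjection with hp
  by_contra! hcon
  choose x hx hlt using fun n : ℕ => hcon ((n : ℝ) + 1) (by positivity)
  have hpos : ∀ n, 0 < ‖p (x n - f)‖ := fun n => lt_trans (by positivity) (hlt n)
  have hmem : ∀ n, f + p (x n - f) ∈ B := fun n => by
    refine (mem_iff_of_sub_mem_lin ?_).1 (hx n)
    have := sub_orthogonal_starProjection_mem (lin B) (x n - f)
    rwa [← sub_sub]
  obtain ⟨u, hu, φ, hφ, hlim⟩ := (isCompact_sphere (0 : E q) 1).tendsto_subseq
    (x := fun n => ‖p (x n - f)‖⁻¹ • p (x n - f)) (fun n => by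
      rw [mem_sphere_zero_iff_norm, norm_smul, norm_inv, norm_norm,
        inv_mul_cancel₀ (hpos n).ne'])
  have huperp : u ∈ (lin B)ᗮ :=
    (Submodule.isClosed_orthogonal _).mem_of_tendsto hlim (Eventually.of_forall fun n =>
      Submodule.smul_mem _ _ (orthogonal_starProjection_mem _ _))
  have hulin : u ∈ lin B := by
    refine hB.mem_lin_of_ray hf fun t ht => ?_
    refine (hB.isClosed hf).mem_of_tendsto ((hlim.const_smul t).const_add f) ?_
    obtain ⟨N, hN⟩ := exists_nat_ge t
    filter_upwards [eventually_ge_atTop N] with n hn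
    have h1 : t ≤ ‖p (x (φ n) - f)‖ := by
      have h2 := hlt (φ n)
      have h3 : (N : ℝ) ≤ φ n := by exact_mod_cast hn.trans (hφ.id_le n)
      linarith
    -- Once the projection is longer than `t`, the point at distance `t` from `f` in its direction
    -- lies on a segment in `B`.
    have h2 := hB.convex.add_smul_mem (x := f) (y := p (x (φ n) - f)) (interior_subset hf)
      (hmem _) (t := t * ‖p (x (φ n) - f)‖⁻¹)
      ⟨mul_nonneg ht (inv_nonneg.2 (hpos _).le), by
        rw [← div_eq_mul_inv]
        exact (div_le_one (hpos _)).2 h1⟩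
    simpa [smul_smul] using h2
  have : u = 0 := by
    have := Submodule.inner_right_of_mem_orthogonal hulin huperp
    exact inner_self_eq_zero.1 this
  simp [this] at hu

/-- The lineality space is rational. -/
lemma IsMaximalLatticeFreeConvex.isRationalSpace_lin (hB : IsMaximalLatticeFreeConvex B)
    (hf : f ∈ interior B) : IsRationalSpace (lin B) := by
  set p := (lin B)ᗮ.starProjection with hp
  set V := Submodule.span ℝ {x : E q | x ∈ lin B ∧ x ∈ integralPoints q} with hV
  have hVL : V ≤ lin B := Submodule.span_le.2 fun x hx => hx.1
  refine le_antisymm hVL fun y hy => ?_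
  set u := Vᗮ.starProjection y with hu
  suffices u = 0 from orthogonal_starProjection_eq_zero_iff.1 this
  have huV : u ∈ Vᗮ := orthogonal_starProjection_mem _ _
  have huL : u ∈ lin B := by
    have := (lin B).sub_mem hy (hVL (sub_orthogonal_starProjection_mem V y))
    rwa [sub_sub_cancel] at this
  by_contra hne
  have hpos : 0 < ‖u‖ := norm_pos_iff.2 hne
  -- Steps of length `N ‖u‖ > 2 √q` exceed the total error of rounding two points.
  obtain ⟨N, hN⟩ := exists_nat_gt (2 * √q / ‖u‖)
  have hfin := hB.finite_projections hf (√q)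
  have hmaps : ∀ n : ℕ, p (floorPoint (((n * N : ℕ) : ℝ) • u)) ∈
      p '' integralPoints q ∩ {x | ‖x‖ ≤ √q} := fun n => by
    refine ⟨⟨_, floorPoint_mem _, rfl⟩, ?_⟩
    have h0 : p (((n * N : ℕ) : ℝ) • u) = 0 :=
      orthogonal_starProjection_eq_zero_iff.2 ((lin B).smul_mem _ huL)
    have h1 : p (floorPoint (((n * N : ℕ) : ℝ) • u)) =
        -p (((n * N : ℕ) : ℝ) • u - floorPoint (((n * N : ℕ) : ℝ) • u)) := by
      rw [map_sub, h0]
      simp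
    rw [Set.mem_ofPred_eq, h1, norm_neg]
    exact (Submodule.norm_starProjection_apply_le _ _).trans (norm_sub_floorPoint_le _)
  -- Two rounded multiples of `u` with equal projection differ by an integral vector of `lin B`,
  -- which is orthogonal to `u`; yet it is within `2 √q` of `(n - m) N u`.
  obtain ⟨m, -, n, -, hmn, heq⟩ := Set.infinite_univ.exists_lt_map_eq_of_mapsTo
    (fun n _ => hmaps n) hfin
  set a := ((m * N : ℕ) : ℝ) • u with ha
  set b := ((n * N : ℕ) : ℝ) • u with hb
  have hw : floorPoint b - floorPoint a ∈ V := by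
    refine Submodule.subset_span ⟨orthogonal_starProjection_eq_zero_iff.1 ?_,
      integralPoints_sub (floorPoint_mem _) (floorPoint_mem _)⟩
    rw [map_sub, sub_eq_zero]
    exact heq.symm
  have hin : inner ℝ (floorPoint b - floorPoint a) u = 0 :=
    Submodule.inner_right_of_mem_orthogonal hw huV
  have hba : b - a = (((n : ℝ) - m) * N) • u := by
    rw [ha, hb]
    push_cast
    module
  have h1 : inner ℝ (b - a) u = inner ℝ ((b - floorPoint b) - (a - floorPoint a)) u := by
    have : (b - floorPoint b) - (a - floorPoint a) = (b - a) - (floorPoint b - floorPoint a) := by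
      abel
    rw [this, inner_sub_left _ (floorPoint b - floorPoint a), hin, sub_zero]
  have h2 : inner ℝ ((b - floorPoint b) - (a - floorPoint a)) u ≤ 2 * √q * ‖u‖ := by
    refine (real_inner_le_norm _ _).trans ?_
    gcongr
    refine (norm_sub_le _ _).trans ?_
    linarith [norm_sub_floorPoint_le a, norm_sub_floorPoint_le b]
  rw [← h1, hba, real_inner_smul_left, real_inner_self_eq_norm_sq] at h2
  have hnm : (1 : ℝ) ≤ n - m := by
    have : (m : ℝ) + 1 ≤ n := by exact_mod_cast hmn
    linarith
  rw [div_lt_iff₀ hpos] at hN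
  have hN0 : (0 : ℝ) ≤ N * ‖u‖ := by positivity
  have h3 : N * ‖u‖ * ‖u‖ ≤ 2 * √q * ‖u‖ := by
    refine le_trans ?_ h2
    nlinarith [mul_nonneg hN0 hpos.le]
  nlinarith

end Maximal

/-! ### Polyhedrality of `B` and the polytope section. -/

section Polyhedron

variable {B : Set (E q)} {f : E q}

lemma exists_pos_add_smul_mem {C : Set (E q)} {x : E q} (hx : x ∈ interior C) (d : E q) :
    ∃ t > (0 : ℝ), x + t • d ∈ C := by
  have hlim : Tendsto (fun t : ℝ => x + t • d) (𝓝[>] 0) (𝓝 x) := by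
    have h : Continuous fun t : ℝ => x + t • d := by fun_prop
    have := h.tendsto 0
    rw [zero_smul, add_zero] at this
    exact this.mono_left nhdsWithin_le_nhds
  have h1 := hlim.eventually (mem_interior_iff_mem_nhds.1 hx)
  obtain ⟨t, ht, ht0⟩ := (h1.and self_mem_nhdsWithin).exists
  exact ⟨t, ht0, ht⟩

lemma convex_setOf_inner_le_one (A : Set (E q)) (f : E q) :
    Convex ℝ {x : E q | ∀ a ∈ A, inner ℝ a (x - f) ≤ 1} := by
  intro x hx y hy s t hs ht hst a ha
  have : s • x + t • y - f = s • (x - f) + t • (y - f) := by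
    obtain rfl : t = 1 - s := by linarith
    module
  rw [this, inner_add_right, real_inner_smul_right, real_inner_smul_right]
  nlinarith [hx a ha, hy a ha]

/-- Every integral point is cut off by a halfspace containing `B`. -/
lemma IsMaximalLatticeFreeConvex.exists_halfspace (hB : IsMaximalLatticeFreeConvex B)
    (hf : f ∈ interior B) {z : E q} (hz : z ∈ integralPoints q) :
    ∃ a : E q, (∀ x ∈ B, inner ℝ a (x - f) ≤ 1) ∧ inner ℝ a (z - f) = 1 := by
  obtain ⟨g, hg⟩ := geometric_hahn_banach_open_point hB.convex.interior isOpen_interior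
    (fun h => hB.prop.2 z h hz)
  have hle : ∀ x ∈ B, g x ≤ g z := fun x hx => by
    rw [← hB.closure_interior hf] at hx
    exact closure_minimal (fun y hy => (hg y hy).le)
      (isClosed_le g.continuous continuous_const) hx
  have hc : 0 < g (z - f) := by
    rw [map_sub]
    linarith [hg f hf]
  refine ⟨(g (z - f))⁻¹ • (InnerProductSpace.toDual ℝ (E q)).symm g, fun x hx => ?_, ?_⟩
  · rw [real_inner_smul_left, InnerProductSpace.toDual_symm_apply, inv_mul_le_iff₀ hc, mul_one,
      map_sub, map_sub]
    linarith [hle x hx]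
  · rw [real_inner_smul_left, InnerProductSpace.toDual_symm_apply, inv_mul_cancel₀ hc.ne']

lemma inner_eq_zero_of_mem_lin (hf : f ∈ B) {a : E q} (ha : ∀ x ∈ B, inner ℝ a (x - f) ≤ 1)
    {l : E q} (hl : l ∈ lin B) : inner ℝ a l = 0 := by
  by_contra hne
  have := ha _ (hl f hf (2 / inner ℝ a l))
  rw [add_sub_cancel_left, real_inner_smul_right, div_mul_cancel₀ _ hne] at this
  linarith

/-- A maximal lattice-free convex set with interior is a polyhedron. -/
lemma IsMaximalLatticeFreeConvex.exists_finite_inner_le_one (hB : IsMaximalLatticeFreeConvex B)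
    (hf : f ∈ interior B) :
    ∃ A : Set (E q), A.Finite ∧ B = {x | ∀ a ∈ A, inner ℝ a (x - f) ≤ 1} := by
  obtain ⟨R, hR, hbd⟩ := hB.exists_projection_bound hf
  set p := (lin B)ᗮ.starProjection with hp
  -- One normal serves a whole fibre of the projection, because it vanishes on `lin B`.
  have hsep : ∀ y : E q, ∃ a : E q, y ∈ p '' integralPoints q →
      (∀ x ∈ B, inner ℝ a (x - f) ≤ 1) ∧
        ∀ z ∈ integralPoints q, p z = y → inner ℝ a (z - f) = 1 := by
    intro y
    by_cases hy : y ∈ p '' integralPoints q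
    · obtain ⟨w, hw, rfl⟩ := hy
      obtain ⟨a, ha, haw⟩ := hB.exists_halfspace hf hw
      refine ⟨a, fun _ => ⟨ha, fun z _ hzw => ?_⟩⟩
      have h1 : z - w ∈ lin B := orthogonal_starProjection_eq_zero_iff.1 (by
        rw [map_sub, sub_eq_zero]
        exact hzw)
      have h2 := inner_eq_zero_of_mem_lin (interior_subset hf) ha h1
      have h3 : z - f = (z - w) + (w - f) := by abel
      rw [h3, inner_add_right, h2, haw, zero_add]
    · exact ⟨0, fun h => absurd h hy⟩
  choose a ha using hsep
  set S := p '' integralPoints q ∩ {x | ‖x‖ ≤ √(q * R ^ 2) + ‖p f‖} with hS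
  have hSfin : S.Finite := hB.finite_projections hf _
  set e : Fin q → E q := fun i => EuclideanSpace.single i (1 : ℝ) with he
  have hpe : ∀ (i : Fin q) (x : E q), inner ℝ (p (e i)) x = p x i := fun i x => by
    rw [hp, Submodule.inner_starProjection_left_eq_right, EuclideanSpace.inner_single_left]
    simp
  -- Box constraints modulo `lin B` leave only the finitely many projected lattice points of `S` to
  -- be cut off.
  set A : Set (E q) := (Set.range fun i => R⁻¹ • p (e i)) ∪
    (Set.range fun i => (-R⁻¹) • p (e i)) ∪ a '' S with hA
  have hsub : B ⊆ {x | ∀ a ∈ A, inner ℝ a (x - f) ≤ 1} := by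
    rintro x hx b ((⟨i, rfl⟩ | ⟨i, rfl⟩) | ⟨y, hy, rfl⟩)
    · have h1 := (PiLp.norm_apply_le (p (x - f)) i).trans (hbd x hx)
      rw [real_inner_smul_left, hpe, inv_mul_le_iff₀ hR, mul_one]
      exact (le_abs_self _).trans h1
    · have h1 := (PiLp.norm_apply_le (p (x - f)) i).trans (hbd x hx)
      rw [real_inner_smul_left, hpe, neg_mul, ← mul_neg, inv_mul_le_iff₀ hR, mul_one]
      exact (neg_le_abs _).trans h1
    · exact (ha y hy.1).1 x hx
  refine ⟨A, ((Set.finite_range _).union (Set.finite_range _)).union (hSfin.image _),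
    hB.eq_of_subset (convex_setOf_inner_le_one A f) (fun z hzi hz => ?_) hsub⟩
  have hzC := interior_subset hzi
  have hcoord : ∀ i, |p (z - f) i| ≤ R := fun i => by
    have h1 := hzC _ (Or.inl (Or.inl ⟨i, rfl⟩))
    have h2 := hzC _ (Or.inl (Or.inr ⟨i, rfl⟩))
    rw [real_inner_smul_left, hpe, inv_mul_le_iff₀ hR, mul_one] at h1
    rw [real_inner_smul_left, hpe, neg_mul, ← mul_neg, inv_mul_le_iff₀ hR, mul_one] at h2
    exact abs_le.2 ⟨by linarith, h1⟩
  have hnorm : ‖p (z - f)‖ ≤ √(q * R ^ 2) := by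
    rw [EuclideanSpace.norm_eq]
    apply Real.sqrt_le_sqrt
    calc ∑ i, ‖p (z - f) i‖ ^ 2 ≤ ∑ _i : Fin q, R ^ 2 := by
          refine Finset.sum_le_sum fun i _ => ?_
          exact pow_le_pow_left₀ (norm_nonneg _) (hcoord i) 2
      _ = q * R ^ 2 := by simp
  have hzS : p z ∈ S := by
    refine ⟨⟨z, hz, rfl⟩, ?_⟩
    have : p z = p (z - f) + p f := by rw [map_sub, sub_add_cancel]
    rw [Set.mem_ofPred_eq, this]
    exact (norm_add_le _ _).trans (by linarith)
  have h1 := (ha (p z) hzS.1).2 z hz rfl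
  -- An interior point could be pushed further from `f`, past the hyperplane through `z`.
  obtain ⟨t, ht, hmem⟩ := exists_pos_add_smul_mem hzi (z - f)
  have h2 := hmem _ (Or.inr ⟨p z, hzS, rfl⟩)
  rw [add_sub_right_comm, inner_add_right, real_inner_smul_right, h1] at h2
  linarith

lemma eq_orthSection_add_lin (f : E q) (B : Set (E q)) :
    B = orthSection f B + (lin B : Set (E q)) := by
  ext x
  constructor
  · intro hx
    have hl := sub_orthogonal_starProjection_mem (lin B) (x - f)
    set y := (lin B)ᗮ.starProjection (x - f) with hy
    refine ⟨x - (x - f - y), ⟨?_, ?_⟩, _, hl, by simp⟩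
    · exact (mem_iff_of_sub_mem_lin (by simpa using hl)).1 hx
    · have : x - (x - f - y) - f = y := by abel
      rw [this]
      exact orthogonal_starProjection_mem _ _
  · rintro ⟨y, hy, l, hl, rfl⟩
    exact add_mem_of_mem_lin hy.1 hl

lemma convex_orthSection (hB : Convex ℝ B) : Convex ℝ (orthSection f B) := by
  intro x hx y hy s t hs ht hst
  refine ⟨hB hx.1 hy.1 hs ht hst, ?_⟩
  have : s • x + t • y - f = s • (x - f) + t • (y - f) := by
    obtain rfl : t = 1 - s := by linarith
    module
  rw [this]
  exact Submodule.add_mem _ (Submodule.smul_mem _ _ hx.2) (Submodule.smul_mem _ _ hy.2)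

lemma IsMaximalLatticeFreeConvex.isCompact_orthSection (hB : IsMaximalLatticeFreeConvex B)
    (hf : f ∈ interior B) : IsCompact (orthSection f B) := by
  obtain ⟨R, hR, hbd⟩ := hB.exists_projection_bound hf
  refine Metric.isCompact_of_isClosed_isBounded ?_ ?_
  · exact (hB.isClosed hf).inter ((Submodule.isClosed_orthogonal (lin B)).preimage
      (continuous_id.sub continuous_const : Continuous fun x : E q => x - f))
  · refine (Metric.isBounded_closedBall (x := f) (r := R)).subset fun x hx => ?_
    have := hbd x hx.1
    rwa [Submodule.starProjection_eq_self_iff.2 hx.2, ← dist_eq_norm] at this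

/-- An extreme point is determined by its set of tight constraints: if `y` has the same ones as `x`,
the segment from `y` to `x` extends slightly beyond `x` within the section, so extremality gives `x
= y`. -/
lemma IsMaximalLatticeFreeConvex.finite_extremePoints_orthSection
    (hB : IsMaximalLatticeFreeConvex B) (hf : f ∈ interior B) :
    ((orthSection f B).extremePoints ℝ).Finite := by
  obtain ⟨A, hA, hBA⟩ := hB.exists_finite_inner_le_one hf
  refine Set.Finite.of_injOn (f := fun x => {a ∈ A | inner ℝ a (x - f) = 1})
    (t := A.powerset) (fun x _ => Set.sep_subset _ _) ?_ hA.finite_subsets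
  intro x hx y hy hxy
  have hmem : ∀ w ∈ B, ∀ a ∈ A, inner ℝ a (w - f) ≤ 1 := fun w hw => by
    rw [hBA] at hw
    exact hw
  have hev : ∀ a ∈ A, ∀ᶠ t : ℝ in 𝓝[>] 0, inner ℝ a (x + t • (x - y) - f) ≤ 1 := by
    intro a ha
    rcases (hmem x hx.1.1 a ha).lt_or_eq with hlt | heq
    · have hc : Continuous fun t : ℝ => inner ℝ a (x + t • (x - y) - f) := by fun_prop
      have h1 := (hc.tendsto 0).mono_left (nhdsWithin_le_nhds (s := Set.Ioi 0))
      rw [zero_smul, add_zero] at h1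
      exact (h1.eventually (gt_mem_nhds hlt)).mono fun t ht => ht.le
    · have h1 : a ∈ {a ∈ A | inner ℝ a (y - f) = 1} := by
        have h0 : {a ∈ A | inner ℝ a (x - f) = 1} = {a ∈ A | inner ℝ a (y - f) = 1} := hxy
        rw [← h0]
        exact ⟨ha, heq⟩
      refine Eventually.of_forall fun t => ?_
      have h2 : x + t • (x - y) - f = (x - f) + t • ((x - f) - (y - f)) := by module
      rw [h2, inner_add_right, real_inner_smul_right, inner_sub_right (y := x - f), heq, h1.2]
      simp
  obtain ⟨t, ht, ht0⟩ := (((eventually_all_finite hA).2 hev).and self_mem_nhdsWithin).exists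
  have ht0 : 0 < t := ht0
  have hP : x + t • (x - y) ∈ orthSection f B := by
    refine ⟨by rw [hBA]; exact ht, ?_⟩
    have h2 : x + t • (x - y) - f = (x - f) + t • ((x - f) - (y - f)) := by module
    rw [h2]
    exact Submodule.add_mem _ hx.1.2
      (Submodule.smul_mem _ _ (Submodule.sub_mem _ hx.1.2 hy.1.2))
  have hseg : x ∈ openSegment ℝ y (x + t • (x - y)) := by
    refine ⟨t / (1 + t), 1 / (1 + t), by positivity, by positivity, by field_simp; ring, ?_⟩
    have h1 : (1 : ℝ) + t ≠ 0 := by positivity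
    rw [smul_add, smul_smul, ← sub_eq_zero]
    have : (t / (1 + t)) • y + ((1 / (1 + t)) • x + (1 / (1 + t) * t) • (x - y)) - x
      = ((1 / (1 + t)) + (1 / (1 + t) * t) - 1) • x + (t / (1 + t) - 1 / (1 + t) * t) • y := by
      module
    rw [this]
    have e1 : (1 / (1 + t)) + (1 / (1 + t) * t) - 1 = 0 := by field_simp; ring
    have e2 : t / (1 + t) - 1 / (1 + t) * t = 0 := by ring
    rw [e1, e2]
    simp
  exact (hx.2 hy.1 hP hseg).symm

lemma IsMaximalLatticeFreeConvex.orthSection_eq_convexHull (hB : IsMaximalLatticeFreeConvex B)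
    (hf : f ∈ interior B) :
    orthSection f B = convexHull ℝ ((orthSection f B).extremePoints ℝ) := by
  rw [← ((hB.finite_extremePoints_orthSection hf).isClosed_convexHull ℝ).closure_eq]
  exact (closure_convexHull_extremePoints (hB.isCompact_orthSection hf)
    (convex_orthSection hB.convex)).symm

end Polyhedron

/-! ### Sublinear functions and their unit level sets. -/

section Sublinear

/-- Subadditive and positively homogeneous functions. -/
structure IsSublinear (g : E q → ℝ) : Prop where
  add_le : ∀ x y, g (x + y) ≤ g x + g y
  smul_eq : ∀ c : ℝ, 0 ≤ c → ∀ x, g (c • x) = c * g x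

variable {g g₁ g₂ ψ : E q → ℝ} {B : Set (E q)} {f : E q}

lemma IsSublinear.zero (hg : IsSublinear g) : g 0 = 0 := by
  have := hg.smul_eq 0 le_rfl 0
  simpa using this

lemma IsSublinear.add_neg_nonneg (hg : IsSublinear g) (x : E q) : 0 ≤ g x + g (-x) := by
  have := hg.add_le x (-x)
  rwa [add_neg_cancel, hg.zero] at this

lemma IsSublinear.sum_le (hg : IsSublinear g) {ι : Type*} (s : Finset ι) (c : ι → ℝ)
    (hc : ∀ i, 0 ≤ c i) (r : ι → E q) : g (∑ i ∈ s, c i • r i) ≤ ∑ i ∈ s, c i * g (r i) :=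
  (Finset.le_sum_of_subadditive g hg.zero.le hg.add_le s _).trans
    (Finset.sum_le_sum fun i _ => (hg.smul_eq _ (hc i) _).le)

lemma IsSublinear.half_add (h₁ : IsSublinear g₁) (h₂ : IsSublinear g₂) :
    IsSublinear fun x => (1 / 2 : ℝ) * (g₁ x + g₂ x) where
  add_le x y := by linarith [h₁.add_le x y, h₂.add_le x y]
  smul_eq c hc x := by rw [h₁.smul_eq c hc, h₂.smul_eq c hc]; ring

/-- A sublinear function that is at least `1` at every `z - f` with `z` integral gives a valid
inequality for every family of vectors. -/
lemma IsSublinear.isValid (hg : IsSublinear g)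
    (hz : ∀ z ∈ integralPoints q, 1 ≤ g (z - f)) {ι : Type} (r : ι → E q) :
    IsValid (Rf f r) (fun i => g (r i)) := by
  rintro s ⟨hs, hs0⟩
  refine (hz _ hs).trans ?_
  rw [add_sub_cancel_left]
  refine (hg.sum_le s.support s hs0 r).trans_eq ?_
  exact Finset.sum_congr rfl fun i _ => mul_comm _ _

lemma IsSublinear.le_zero_of_mem_lin (hg : IsSublinear g) (hf : f ∈ B)
    (hl : ∀ x, x ∈ B ↔ g (x - f) ≤ 1) {r : E q} (hr : r ∈ lin B) : g r ≤ 0 := by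
  by_contra! hpos
  have := (hl _).1 (hr f hf (2 / g r))
  rw [add_sub_cancel_left, hg.smul_eq _ (by positivity), div_mul_cancel₀ _ hpos.ne'] at this
  linarith

lemma IsSublinear.mem_lin_of_le_zero (hg : IsSublinear g) (hB : IsMaximalLatticeFreeConvex B)
    (hf : f ∈ interior B) (hl : ∀ x, x ∈ B ↔ g (x - f) ≤ 1) {r : E q} (hr : g r ≤ 0) :
    r ∈ lin B := by
  refine hB.mem_lin_of_ray hf fun t ht => (hl _).2 ?_
  rw [add_sub_cancel_left, hg.smul_eq t ht]
  nlinarith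

/-- A negative value would put `x`, hence `-x`, in `lin B`, making `g x + g (-x)` negative. -/
lemma IsSublinear.nonneg_of_level (hg : IsSublinear g) (hB : IsMaximalLatticeFreeConvex B)
    (hf : f ∈ interior B) (hl : ∀ x, x ∈ B ↔ g (x - f) ≤ 1) (x : E q) : 0 ≤ g x := by
  by_contra! hneg
  have h1 := hg.le_zero_of_mem_lin (interior_subset hf) hl
    ((lin B).neg_mem (hg.mem_lin_of_le_zero hB hf hl hneg.le))
  linarith [hg.add_neg_nonneg x]

lemma IsSublinear.eq_zero_of_mem_lin (hg : IsSublinear g) (hB : IsMaximalLatticeFreeConvex B)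
    (hf : f ∈ interior B) (hl : ∀ x, x ∈ B ↔ g (x - f) ≤ 1) {r : E q} (hr : r ∈ lin B) :
    g r = 0 :=
  le_antisymm (hg.le_zero_of_mem_lin (interior_subset hf) hl hr) (hg.nonneg_of_level hB hf hl r)

lemma IsSublinear.le_of_level (h₁ : IsSublinear g₁) (h₂ : IsSublinear g₂)
    (hnn : ∀ x, 0 ≤ g₂ x) (hl : ∀ x, g₂ x ≤ 1 → g₁ x ≤ 1) (x : E q) : g₁ x ≤ g₂ x := by
  refine le_of_forall_gt_imp_ge_of_dense fun c hc => ?_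
  have hc0 : 0 < c := (hnn x).trans_lt hc
  have h := hl (c⁻¹ • x) (by
    rw [h₂.smul_eq _ (by positivity), inv_mul_le_iff₀ hc0, mul_one]
    exact hc.le)
  rwa [h₁.smul_eq _ (by positivity), inv_mul_le_iff₀ hc0, mul_one] at h

/-- A sublinear function is determined by its unit level set, when that is maximal lattice-free. -/
lemma IsSublinear.eq_of_level (h₁ : IsSublinear g₁) (h₂ : IsSublinear g₂)
    (hB : IsMaximalLatticeFreeConvex B) (hf : f ∈ interior B)
    (hl₁ : ∀ x, x ∈ B ↔ g₁ (x - f) ≤ 1) (hl₂ : ∀ x, x ∈ B ↔ g₂ (x - f) ≤ 1) : g₁ = g₂ := by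
  have hiff : ∀ x, g₁ x ≤ 1 ↔ g₂ x ≤ 1 := fun x => by
    have h1 := hl₁ (f + x)
    have h2 := hl₂ (f + x)
    rw [add_sub_cancel_left] at h1 h2
    exact h1.symm.trans h2
  funext x
  exact le_antisymm
    (h₁.le_of_level h₂ (h₂.nonneg_of_level hB hf hl₂) (fun y => (hiff y).2) x)
    (h₂.le_of_level h₁ (h₁.nonneg_of_level hB hf hl₁) (fun y => (hiff y).1) x)

/-- The gauge of a maximal lattice-free convex set is minimal among the sublinear functions giving
valid inequalities. -/
lemma IsSublinear.eq_of_le (hg : IsSublinear g) (hψ : IsSublinear ψ)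
    (hB : IsMaximalLatticeFreeConvex B) (hf : f ∈ interior B)
    (hl : ∀ x, x ∈ B ↔ ψ (x - f) ≤ 1) (hz : ∀ z ∈ integralPoints q, 1 ≤ g (z - f))
    (hle : ∀ x, g x ≤ ψ x) : g = ψ := by
  -- The level set of the smaller function contains `B` and is still lattice-free, so maximality
  -- leaves no room.
  have hBC : B = {x | g (x - f) ≤ 1} := by
    refine hB.eq_of_subset ?_ ?_ fun x hx => (hle _).trans ((hl x).1 hx)
    · intro x hx y hy s t hs ht hst
      have e : s • x + t • y - f = s • (x - f) + t • (y - f) := by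
        obtain rfl : t = 1 - s := by linarith
        module
      have hx' : g (x - f) ≤ 1 := hx
      have hy' : g (y - f) ≤ 1 := hy
      rw [Set.mem_ofPred_eq, e]
      refine (hg.add_le _ _).trans ?_
      rw [hg.smul_eq s hs, hg.smul_eq t ht]
      nlinarith
    · intro z hzi hzZ
      obtain ⟨t, ht, hmem⟩ := exists_pos_add_smul_mem hzi (z - f)
      have e : z + t • (z - f) - f = (1 + t) • (z - f) := by module
      rw [Set.mem_ofPred_eq, e, hg.smul_eq _ (by positivity)] at hmem
      nlinarith [hz z hzZ]
  exact hg.eq_of_level hψ hB hf (fun x => by nth_rewrite 1 [hBC]; rfl) hl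

end Sublinear

/-! ### The gauge `ψ_B` and the vertices of the section. -/

section Psi

variable {B : Set (E q)} {f : E q} {ψ : E q → ℝ}

lemma IsPsi.isSublinear (h : IsPsi f B ψ) : IsSublinear ψ := by
  obtain ⟨t, a, -, hψ⟩ := h
  constructor
  · intro x y
    obtain ⟨i, hi⟩ := (hψ (x + y)).1
    simp only [inner_add_right] at hi
    have h1 := (hψ x).2 ⟨i, rfl⟩
    have h2 := (hψ y).2 ⟨i, rfl⟩
    simp only at h1 h2
    linarith
  · intro c hc x
    refine (hψ (c • x)).unique ⟨?_, ?_⟩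
    · obtain ⟨i, hi⟩ := (hψ x).1
      exact ⟨i, by simp only [real_inner_smul_right]; rw [← hi]⟩
    · rintro _ ⟨i, rfl⟩
      simp only [real_inner_smul_right]
      exact mul_le_mul_of_nonneg_left ((hψ x).2 ⟨i, rfl⟩) hc

lemma IsPsi.mem_iff (h : IsPsi f B ψ) (x : E q) : x ∈ B ↔ ψ (x - f) ≤ 1 := by
  obtain ⟨t, a, hB, hψ⟩ := h
  rw [hB]
  constructor
  · intro hx
    obtain ⟨i, hi⟩ := (hψ (x - f)).1
    rw [← hi]
    exact hx i
  · intro hx i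
    exact ((hψ (x - f)).2 ⟨i, rfl⟩).trans hx

lemma IsPsi.mem_interior (h : IsPsi f B ψ) {x : E q} (hx : ψ (x - f) < 1) : x ∈ interior B := by
  obtain ⟨t, a, hB, hψ⟩ := h
  have hopen : IsOpen (⋂ i, {y : E q | inner ℝ (a i) (y - f) < 1}) :=
    isOpen_iInter_of_finite fun i => isOpen_lt (by fun_prop) continuous_const
  refine interior_maximal (fun y hy => ?_) hopen
    (Set.mem_iInter.2 fun i => ((hψ (x - f)).2 ⟨i, rfl⟩).trans_lt hx)
  rw [hB]
  exact fun i => (Set.mem_iInter.1 hy i).le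

lemma IsPsi.one_le (h : IsPsi f B ψ) (hB : IsMaximalLatticeFreeConvex B) {z : E q}
    (hz : z ∈ integralPoints q) : 1 ≤ ψ (z - f) := by
  by_contra! hlt
  exact hB.prop.2 z (h.mem_interior hlt) hz

lemma IsMaximalLatticeFreeConvex.ne_univ (hB : IsMaximalLatticeFreeConvex B) : B ≠ Set.univ := by
  rintro rfl
  exact hB.prop.2 0 (by simp) integralPoints_zero

lemma IsMaximalLatticeFreeConvex.exists_isPsi (hB : IsMaximalLatticeFreeConvex B)
    (hf : f ∈ interior B) : ∃ ψ, IsPsi f B ψ := by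
  obtain ⟨A, hA, hBA⟩ := hB.exists_finite_inner_le_one hf
  -- At least one inequality is needed for the maximum to exist.
  have hne : A.Nonempty := by
    rw [Set.nonempty_iff_ne_empty]
    rintro rfl
    exact hB.ne_univ (by simpa using hBA)
  have := hA.to_subtype
  have := hne.to_subtype
  let e := Finite.equivFin A
  have hmax : ∀ r : E q, ∃ m, IsGreatest (Set.range fun i => inner ℝ (e.symm i : E q) r) m := by
    intro r
    have : Nonempty (Fin (Nat.card A)) := e.symm.nonempty
    exact (Set.finite_range _).isCompact.exists_isGreatest (Set.range_nonempty _)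
  choose ψ hψ using hmax
  refine ⟨ψ, Nat.card A, fun i => e.symm i, ?_, hψ⟩
  rw [hBA]
  ext x
  constructor
  · intro hx i
    exact hx _ (e.symm i).2
  · intro hx a ha
    have h1 : inner ℝ (e.symm (e ⟨a, ha⟩) : E q) (x - f) ≤ 1 := hx _
    rwa [Equiv.symm_apply_apply] at h1

lemma IsMaximalLatticeFreeConvex.existsUnique_isPsi (hB : IsMaximalLatticeFreeConvex B)
    (hf : f ∈ interior B) : ∃! ψ, IsPsi f B ψ := by
  obtain ⟨ψ, hψ⟩ := hB.exists_isPsi hf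
  exact ⟨ψ, hψ, fun ψ' hψ' =>
    hψ'.isSublinear.eq_of_level hψ.isSublinear hB hf hψ'.mem_iff hψ.mem_iff⟩

lemma exists_weights_of_mem_convexHull_range {ι : Type*} [Fintype ι] {v : ι → E q} {x : E q}
    (hx : x ∈ convexHull ℝ (Set.range v)) :
    ∃ w : ι → ℝ, (∀ i, 0 ≤ w i) ∧ ∑ i, w i = 1 ∧ ∑ i, w i • v i = x := by
  classical
  refine convexHull_min (t := {x | ∃ w : ι → ℝ, (∀ i, 0 ≤ w i) ∧ ∑ i, w i = 1 ∧
    ∑ i, w i • v i = x}) ?_ ?_ hx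
  · rintro _ ⟨i, rfl⟩
    refine ⟨Pi.single i 1, fun j => ?_, by simp, ?_⟩
    · by_cases h : j = i
      · subst h; simp
      · simp [h]
    · rw [Finset.sum_eq_single i] <;> simp +contextual
  · rintro _ ⟨w, hw, hw1, rfl⟩ _ ⟨w', hw', hw1', rfl⟩ s t hs ht hst
    refine ⟨fun i => s * w i + t * w' i, fun i => ?_, ?_, ?_⟩
    · have := hw i
      have := hw' i
      positivity
    · rw [Finset.sum_add_distrib, ← Finset.mul_sum, ← Finset.mul_sum, hw1, hw1']
      simpa using hst
    · simp only [add_smul, mul_smul, Finset.sum_add_distrib, Finset.smul_sum]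

/-- Modulo the lineality space, each vector is a nonnegative combination of the vertex directions
on which `ψ_B` is additive. -/
lemma IsPsi.exists_combination (h : IsPsi f B ψ) (hB : IsMaximalLatticeFreeConvex B)
    (hf : f ∈ interior B) {k : ℕ} {v : Fin k → E q}
    (hv : Set.range v = (orthSection f B).extremePoints ℝ) (x : E q) :
    ∃ c : Fin k → ℝ, (∀ j, 0 ≤ c j) ∧ x - ∑ j, c j • (v j - f) ∈ lin B ∧ ∑ j, c j = ψ x := by
  have hψ := h.isSublinear
  rcases (hψ.nonneg_of_level hB hf h.mem_iff x).eq_or_lt with h0 | hpos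
  · exact ⟨0, fun _ => le_rfl, by simpa using hψ.mem_lin_of_le_zero hB hf h.mem_iff h0.ge,
      by simpa using h0⟩
  · have hmem : f + (ψ x)⁻¹ • x ∈ B := by
      rw [h.mem_iff, add_sub_cancel_left, hψ.smul_eq _ (by positivity), inv_mul_cancel₀ hpos.ne']
    rw [eq_orthSection_add_lin f B] at hmem
    obtain ⟨p, hp, l, hl, hpl⟩ := hmem
    rw [hB.orthSection_eq_convexHull hf, ← hv] at hp
    obtain ⟨w, hw, hw1, rfl⟩ := exists_weights_of_mem_convexHull_range hp
    refine ⟨fun j => ψ x * w j, fun j => mul_nonneg hpos.le (hw j), ?_, ?_⟩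
    · have hsum : ∑ j, (ψ x * w j) • (v j - f) = ψ x • (∑ j, w j • v j - f) := by
        simp only [mul_smul, ← Finset.smul_sum, smul_sub, Finset.sum_sub_distrib,
          ← Finset.sum_smul, hw1, one_smul]
      have hx : x = ψ x • ((f + (ψ x)⁻¹ • x) - f) := by
        rw [add_sub_cancel_left, smul_smul, mul_inv_cancel₀ hpos.ne', one_smul]
      rw [hsum]
      nth_rewrite 1 [hx]
      rw [← hpl]
      have : ψ x • (∑ j, w j • v j + l - f) - ψ x • (∑ j, w j • v j - f) = ψ x • l := by module
      simp only [this]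
      exact Submodule.smul_mem _ _ hl
    · rw [← Finset.mul_sum, hw1, mul_one]

/-- The vertices of `P` are on the boundary of `B`. -/
lemma IsPsi.one_le_of_mem_extremePoints (h : IsPsi f B ψ) (hB : IsMaximalLatticeFreeConvex B)
    (hf : f ∈ interior B) {v : E q} (hv : v ∈ (orthSection f B).extremePoints ℝ) :
    1 ≤ ψ (v - f) := by
  by_contra! hlt
  have hψ := h.isSublinear
  have hnn := hψ.nonneg_of_level hB hf h.mem_iff
  -- A vertex strictly inside could move both ways along any direction of `(lin B)ᗮ`; so there is
  -- none, and `B` would be the whole space.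
  have hbot : (lin B)ᗮ = ⊥ := by
    rw [Submodule.eq_bot_iff]
    intro d hd
    set c := ψ d + ψ (-d) + 1 with hc
    have hc0 : 0 < c := by linarith [hnn d, hnn (-d)]
    set t := (1 - ψ (v - f)) / c with ht
    have ht0 : 0 < t := div_pos (by linarith) hc0
    have htc : t * c = 1 - ψ (v - f) := div_mul_cancel₀ _ hc0.ne'
    have key : ∀ d' : E q, d' ∈ (lin B)ᗮ → ψ d' ≤ c → v + t • d' ∈ orthSection f B := by
      intro d' hd' hle
      have e : v + t • d' - f = (v - f) + t • d' := by abel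
      refine ⟨(h.mem_iff _).2 ?_, ?_⟩
      · rw [e]
        refine (hψ.add_le _ _).trans ?_
        rw [hψ.smul_eq t ht0.le]
        nlinarith
      · rw [e]
        exact Submodule.add_mem _ hv.1.2 (Submodule.smul_mem _ _ hd')
    have h1 := key d hd (by linarith [hnn (-d)])
    have h2 := key (-d) (Submodule.neg_mem _ hd) (by linarith [hnn d])
    have h3 := hv.2 h1 h2 ⟨1 / 2, 1 / 2, by norm_num, by norm_num, by norm_num, by module⟩
    rw [add_eq_left, smul_eq_zero] at h3
    exact h3.resolve_left ht0.ne'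
  rw [Submodule.orthogonal_eq_bot_iff] at hbot
  refine hB.ne_univ (Set.eq_univ_of_forall fun x => ?_)
  exact (mem_iff_of_sub_mem_lin (by rw [hbot]; exact Submodule.mem_top)).2 (interior_subset hf)

end Psi

/-! ### Sublinear hull of a system of prices. -/

section Hull

variable {ι : Type*}

/-- The sublinear hull of a family of prices `φ i` of vectors `r i`, modulo a subspace `L`. -/
noncomputable def sublinearHull (φ : ι → ℝ) (r : ι → E q) (L : Submodule ℝ (E q)) (x : E q) : ℝ :=
  sInf {y | ∃ s : ι →₀ ℝ, (∀ i, 0 ≤ s i) ∧ x - Finsupp.linearCombination ℝ r s ∈ L ∧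
    Finsupp.linearCombination ℝ φ s = y}

variable {φ : ι → ℝ} {r : ι → E q} {L : Submodule ℝ (E q)} {f : E q}

/-- Such a combination can be added to a representation of `0 - f` without changing it modulo `L`; a
negative price, repeated often enough, would violate validity. -/
lemma linearCombination_nonneg_of_mem
    (hspan : ∀ x, ∃ s : ι →₀ ℝ, (∀ i, 0 ≤ s i) ∧ x - Finsupp.linearCombination ℝ r s ∈ L)
    (hvalid : ∀ s : ι →₀ ℝ, (∀ i, 0 ≤ s i) → ∀ z ∈ integralPoints q,
      z - f - Finsupp.linearCombination ℝ r s ∈ L → 1 ≤ Finsupp.linearCombination ℝ φ s)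
    {s : ι →₀ ℝ} (hs : ∀ i, 0 ≤ s i) (hsL : Finsupp.linearCombination ℝ r s ∈ L) :
    0 ≤ Finsupp.linearCombination ℝ φ s := by
  by_contra! hneg
  obtain ⟨s₀, hs₀, hL₀⟩ := hspan (0 - f)
  set c := |Finsupp.linearCombination ℝ φ s₀| / (-Finsupp.linearCombination ℝ φ s) with hc
  have hc0 : 0 ≤ c := div_nonneg (abs_nonneg _) (by linarith)
  have hcs : c * Finsupp.linearCombination ℝ φ s = -|Finsupp.linearCombination ℝ φ s₀| := by
    rw [hc, div_mul_eq_mul_div, div_eq_iff (neg_ne_zero.2 hneg.ne)]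
    ring
  have h := hvalid (s₀ + c • s) (fun i => by
    have := hs i
    have := hs₀ i
    simp only [Finsupp.add_apply, Finsupp.smul_apply, smul_eq_mul]
    positivity) 0 integralPoints_zero (by
      rw [map_add, map_smul, ← sub_sub]
      exact L.sub_mem hL₀ (L.smul_mem _ hsL))
  rw [map_add, map_smul, smul_eq_mul, hcs] at h
  linarith [le_abs_self (Finsupp.linearCombination ℝ φ s₀)]

/-- A fixed representation of `-x` completes any representation of `x` to one of an element of `L`,
whose price is nonnegative. -/
lemma bddBelow_prices
    (hspan : ∀ x, ∃ s : ι →₀ ℝ, (∀ i, 0 ≤ s i) ∧ x - Finsupp.linearCombination ℝ r s ∈ L)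
    (hvalid : ∀ s : ι →₀ ℝ, (∀ i, 0 ≤ s i) → ∀ z ∈ integralPoints q,
      z - f - Finsupp.linearCombination ℝ r s ∈ L → 1 ≤ Finsupp.linearCombination ℝ φ s)
    (x : E q) :
    BddBelow {y | ∃ s : ι →₀ ℝ, (∀ i, 0 ≤ s i) ∧ x - Finsupp.linearCombination ℝ r s ∈ L ∧
      Finsupp.linearCombination ℝ φ s = y} := by
  obtain ⟨s', hs', hL'⟩ := hspan (-x)
  refine ⟨-Finsupp.linearCombination ℝ φ s', ?_⟩
  rintro _ ⟨s, hs, hL, rfl⟩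
  have := linearCombination_nonneg_of_mem hspan hvalid (s := s + s')
    (fun i => add_nonneg (hs i) (hs' i)) (by
      have h1 := L.neg_mem (L.add_mem hL hL')
      rw [map_add]
      convert h1 using 1
      abel)
  rw [map_add] at this
  linarith

lemma sublinearHull_le
    (hspan : ∀ x, ∃ s : ι →₀ ℝ, (∀ i, 0 ≤ s i) ∧ x - Finsupp.linearCombination ℝ r s ∈ L)
    (hvalid : ∀ s : ι →₀ ℝ, (∀ i, 0 ≤ s i) → ∀ z ∈ integralPoints q,
      z - f - Finsupp.linearCombination ℝ r s ∈ L → 1 ≤ Finsupp.linearCombination ℝ φ s)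
    {x : E q} {s : ι →₀ ℝ} (hs : ∀ i, 0 ≤ s i)
    (hL : x - Finsupp.linearCombination ℝ r s ∈ L) :
    sublinearHull φ r L x ≤ Finsupp.linearCombination ℝ φ s :=
  csInf_le (bddBelow_prices hspan hvalid x) ⟨s, hs, hL, rfl⟩

lemma le_sublinearHull
    (hspan : ∀ x, ∃ s : ι →₀ ℝ, (∀ i, 0 ≤ s i) ∧ x - Finsupp.linearCombination ℝ r s ∈ L)
    {x : E q} {c : ℝ} (h : ∀ s : ι →₀ ℝ, (∀ i, 0 ≤ s i) →
      x - Finsupp.linearCombination ℝ r s ∈ L → c ≤ Finsupp.linearCombination ℝ φ s) :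
    c ≤ sublinearHull φ r L x := by
  obtain ⟨s, hs, hL⟩ := hspan x
  refine le_csInf ⟨_, s, hs, hL, rfl⟩ ?_
  rintro _ ⟨s, hs, hL, rfl⟩
  exact h s hs hL

lemma sublinearHull_apply_le
    (hspan : ∀ x, ∃ s : ι →₀ ℝ, (∀ i, 0 ≤ s i) ∧ x - Finsupp.linearCombination ℝ r s ∈ L)
    (hvalid : ∀ s : ι →₀ ℝ, (∀ i, 0 ≤ s i) → ∀ z ∈ integralPoints q,
      z - f - Finsupp.linearCombination ℝ r s ∈ L → 1 ≤ Finsupp.linearCombination ℝ φ s)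
    (i : ι) : sublinearHull φ r L (r i) ≤ φ i := by
  classical
  have := sublinearHull_le hspan hvalid (x := r i) (s := Finsupp.single i 1)
    (fun j => by rw [Finsupp.single_apply]; split_ifs <;> norm_num) (by simp)
  simpa using this

lemma sublinearHull_smul_le
    (hspan : ∀ x, ∃ s : ι →₀ ℝ, (∀ i, 0 ≤ s i) ∧ x - Finsupp.linearCombination ℝ r s ∈ L)
    (hvalid : ∀ s : ι →₀ ℝ, (∀ i, 0 ≤ s i) → ∀ z ∈ integralPoints q,
      z - f - Finsupp.linearCombination ℝ r s ∈ L → 1 ≤ Finsupp.linearCombination ℝ φ s)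
    {c : ℝ} (hc : 0 < c) (x : E q) :
    sublinearHull φ r L (c • x) ≤ c * sublinearHull φ r L x := by
  rw [← inv_mul_le_iff₀ hc]
  refine le_sublinearHull hspan fun s hs hL => ?_
  rw [inv_mul_le_iff₀ hc, ← smul_eq_mul, ← map_smul]
  refine sublinearHull_le hspan hvalid (fun i => mul_nonneg hc.le (hs i)) ?_
  rw [map_smul, ← smul_sub]
  exact L.smul_mem _ hL

lemma isSublinear_sublinearHull
    (hspan : ∀ x, ∃ s : ι →₀ ℝ, (∀ i, 0 ≤ s i) ∧ x - Finsupp.linearCombination ℝ r s ∈ L)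
    (hvalid : ∀ s : ι →₀ ℝ, (∀ i, 0 ≤ s i) → ∀ z ∈ integralPoints q,
      z - f - Finsupp.linearCombination ℝ r s ∈ L → 1 ≤ Finsupp.linearCombination ℝ φ s) :
    IsSublinear (sublinearHull φ r L) where
  add_le x y := by
    rw [← sub_le_iff_le_add]
    refine le_sublinearHull hspan fun s hs hL => ?_
    rw [sub_le_comm]
    refine le_sublinearHull hspan fun s' hs' hL' => ?_
    rw [sub_le_iff_le_add', ← map_add]
    refine sublinearHull_le hspan hvalid (fun i => add_nonneg (hs i) (hs' i)) ?_
    rw [map_add, add_sub_add_comm]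
    exact L.add_mem hL hL'
  smul_eq c hc x := by
    rcases hc.eq_or_lt with rfl | hc
    · rw [zero_smul, zero_mul]
      refine le_antisymm ?_ (le_sublinearHull hspan fun s hs hL => ?_)
      · have := sublinearHull_le hspan hvalid (x := 0) (s := 0) (fun _ => le_rfl) (by simp)
        simpa using this
      · refine linearCombination_nonneg_of_mem hspan hvalid hs ?_
        simpa using L.neg_mem hL
    · refine le_antisymm (sublinearHull_smul_le hspan hvalid hc x) ?_
      have := sublinearHull_smul_le hspan hvalid (inv_pos.2 hc) (c • x)
      rwa [smul_smul, inv_mul_cancel₀ hc.ne', one_smul, ← div_eq_inv_mul,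
        le_div_iff₀ hc, mul_comm] at this

lemma one_le_sublinearHull
    (hspan : ∀ x, ∃ s : ι →₀ ℝ, (∀ i, 0 ≤ s i) ∧ x - Finsupp.linearCombination ℝ r s ∈ L)
    (hvalid : ∀ s : ι →₀ ℝ, (∀ i, 0 ≤ s i) → ∀ z ∈ integralPoints q,
      z - f - Finsupp.linearCombination ℝ r s ∈ L → 1 ≤ Finsupp.linearCombination ℝ φ s)
    {z : E q} (hz : z ∈ integralPoints q) : 1 ≤ sublinearHull φ r L (z - f) :=
  le_sublinearHull hspan fun s hs hL => hvalid s hs z hz hL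

end Hull

/-! ### Validity under convex hulls and for split finite families. -/

section Valid

lemma isValid_iff {ι : Type} {X : Set (ι →₀ ℝ)} {φ : ι → ℝ} :
    IsValid X φ ↔ ∀ s ∈ X, 1 ≤ Finsupp.linearCombination ℝ φ s := by
  simp only [IsValid, Finsupp.linearCombination_apply, smul_eq_mul, mul_comm]

/-- A valid inequality defines a convex halfspace, so passing to the convex hull changes neither
validity nor extremality. -/
lemma isValid_convexHull_iff {ι : Type} {X : Set (ι →₀ ℝ)} {φ : ι → ℝ} :
    IsValid (convexHull ℝ X) φ ↔ IsValid X φ := by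
  rw [isValid_iff, isValid_iff]
  refine ⟨fun h s hs => h s (subset_convexHull ℝ X hs), fun h s hs => ?_⟩
  exact convexHull_min (t := {s | 1 ≤ Finsupp.linearCombination ℝ φ s}) h
    (convex_halfSpace_ge (Finsupp.linearCombination ℝ φ).isLinear 1) hs

lemma isExtreme_convexHull_iff {ι : Type} {X : Set (ι →₀ ℝ)} {φ : ι → ℝ} :
    IsExtreme (convexHull ℝ X) φ ↔ IsExtreme X φ := by
  simp only [IsExtreme, isValid_convexHull_iff]

lemma isValid_sumElim_iff {f : E q} {k h : ℕ} {r : Fin k → E q} {b : Fin h → E q}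
    {φ : Fin k ⊕ Fin h → ℝ} :
    IsValid (Rf f (Sum.elim r b)) φ ↔ ∀ (c : Fin k → ℝ) (d : Fin h → ℝ), (∀ j, 0 ≤ c j) →
      (∀ j, 0 ≤ d j) → f + (∑ j, c j • r j + ∑ j, d j • b j) ∈ integralPoints q →
      1 ≤ ∑ j, φ (Sum.inl j) * c j + ∑ j, φ (Sum.inr j) * d j := by
  constructor
  · intro H c d hc hd hmem
    have := H (Finsupp.equivFunOnFinite.symm (Sum.elim c d)) ⟨by
      rw [Finsupp.sum_fintype _ _ (by simp), Fintype.sum_sum_type]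
      simpa using hmem, by
      rintro (j | j)
      · exact hc j
      · exact hd j⟩
    rw [Finsupp.sum_fintype _ _ (by simp), Fintype.sum_sum_type] at this
    simpa using this
  · rintro H s ⟨hs, hs0⟩
    rw [Finsupp.sum_fintype _ _ (by simp), Fintype.sum_sum_type] at hs ⊢
    exact H _ _ (fun j => hs0 _) (fun j => hs0 _) hs

end Valid

/-! ### Rational bases and integral translations. -/

section Rational

lemma IsRationalVector.exists_nat_smul {x : E q} (hx : IsRationalVector x) :
    ∃ D : ℕ, 0 < D ∧ (D : ℝ) • x ∈ integralPoints q := by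
  choose c hc using hx
  refine ⟨∏ i, (c i).den, Finset.prod_pos fun i _ => (c i).den_pos, fun i => ?_⟩
  obtain ⟨m, hm⟩ := Finset.dvd_prod_of_mem (fun i => (c i).den) (Finset.mem_univ i)
  refine ⟨m * (c i).num, ?_⟩
  have h1 : ((c i).den : ℝ) * ((c i : ℚ) : ℝ) = (c i).num := by
    exact_mod_cast Rat.den_mul_eq_num (c i)
  rw [PiLp.smul_apply, smul_eq_mul, hc, hm]
  push_cast
  rw [← h1]
  ring

lemma eq_sum_repr_coe {L : Submodule ℝ (E q)} {h : ℕ} (b : Module.Basis (Fin h) ℝ L) {l : E q}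
    (hl : l ∈ L) : l = ∑ j, b.repr ⟨l, hl⟩ j • (b j : E q) := by
  have := congrArg (Submodule.subtype L) (b.sum_repr ⟨l, hl⟩)
  simpa only [map_sum, map_smul, Submodule.subtype_apply] using this.symm

/-- Modulo the integral points, each vector of a space with a rational basis is a nonnegative
combination of the basis. -/
lemma exists_add_integral_eq_sum {L : Submodule ℝ (E q)} {h : ℕ}
    (b : Module.Basis (Fin h) ℝ L) (hb : ∀ j, IsRationalVector (b j : E q)) {l : E q}
    (hl : l ∈ L) : ∃ w ∈ integralPoints q, ∃ d : Fin h → ℝ, (∀ j, 0 ≤ d j) ∧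
      l + w = ∑ j, d j • (b j : E q) := by
  choose D hD hDb using fun j => (hb j).exists_nat_smul
  have hsum := eq_sum_repr_coe b hl
  set c := b.repr ⟨l, hl⟩ with hc
  -- Adding `⌈|c j|⌉₊` copies of the integral vector `D j • b j` makes the coefficient nonnegative,
  -- as `D j ≥ 1`.
  refine ⟨∑ j, ((⌈|c j|⌉₊ : ℤ) : ℝ) • ((D j : ℝ) • (b j : E q)),
    integralPoints_sum _ fun j _ => integralPoints_zsmul (hDb j) _,
    fun j => c j + (⌈|c j|⌉₊ : ℝ) * D j, fun j => ?_, ?_⟩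
  · have h1 := Nat.le_ceil |c j|
    have h2 := neg_abs_le (c j)
    have h3 : (1 : ℝ) ≤ D j := by exact_mod_cast hD j
    nlinarith [abs_nonneg (c j)]
  · simp only [add_smul, Finset.sum_add_distrib, ← hsum, smul_smul, Int.cast_natCast]

end Rational

/-! ### Transfer of extremality in both directions. -/

section Extreme

variable {B : Set (E q)} {f : E q} {ψ : E q → ℝ}

/-- Valid inequalities for all vectors, with mean below the gauge of a maximal lattice-free convex
set, are given by sublinear functions. -/
lemma IsPsi.isSublinear_of_half_add_le (h : IsPsi f B ψ) (hB : IsMaximalLatticeFreeConvex B)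
    (hf : f ∈ interior B) {ψ₁ ψ₂ : E q → ℝ} (h₁ : IsValid (RfAll f) ψ₁)
    (h₂ : IsValid (RfAll f) ψ₂) (hle : ∀ x, (1 / 2 : ℝ) * (ψ₁ x + ψ₂ x) ≤ ψ x) :
    (∀ x, ψ₁ x + ψ₂ x = 2 * ψ x) ∧
      (IsSublinear ψ₁ ∧ ∀ z ∈ integralPoints q, 1 ≤ ψ₁ (z - f)) ∧
      (IsSublinear ψ₂ ∧ ∀ z ∈ integralPoints q, 1 ≤ ψ₂ (z - f)) := by
  classical
  have hspan : ∀ x : E q, ∃ s : E q →₀ ℝ, (∀ i, 0 ≤ s i) ∧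
      x - Finsupp.linearCombination ℝ (fun r : E q => r) s ∈ (⊥ : Submodule ℝ (E q)) := fun x =>
    ⟨Finsupp.single x 1, fun j => by rw [Finsupp.single_apply]; split_ifs <;> norm_num, by simp⟩
  have hvalid : ∀ {φ : E q → ℝ}, IsValid (RfAll f) φ → ∀ s : E q →₀ ℝ, (∀ i, 0 ≤ s i) →
      ∀ z ∈ integralPoints q, z - f - Finsupp.linearCombination ℝ (fun r : E q => r) s ∈
        (⊥ : Submodule ℝ (E q)) → 1 ≤ Finsupp.linearCombination ℝ φ s := by
    intro φ hφ s hs z hz hL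
    refine isValid_iff.1 hφ s ⟨?_, hs⟩
    rw [← Finsupp.linearCombination_apply]
    rw [Submodule.mem_bot, sub_sub, sub_eq_zero] at hL
    rwa [← hL]
  set g₁ := sublinearHull ψ₁ (fun r : E q => r) ⊥ with hg₁
  set g₂ := sublinearHull ψ₂ (fun r : E q => r) ⊥ with hg₂
  have s₁ : IsSublinear g₁ := isSublinear_sublinearHull hspan (hvalid h₁)
  have s₂ : IsSublinear g₂ := isSublinear_sublinearHull hspan (hvalid h₂)
  have z₁ : ∀ z ∈ integralPoints q, 1 ≤ g₁ (z - f) := fun z hz =>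
    one_le_sublinearHull hspan (hvalid h₁) hz
  have z₂ : ∀ z ∈ integralPoints q, 1 ≤ g₂ (z - f) := fun z hz =>
    one_le_sublinearHull hspan (hvalid h₂) hz
  have le₁ : ∀ x, g₁ x ≤ ψ₁ x := sublinearHull_apply_le hspan (hvalid h₁)
  have le₂ : ∀ x, g₂ x ≤ ψ₂ x := sublinearHull_apply_le hspan (hvalid h₂)
  -- Minimality of `ψ` makes the mean of the hulls equal to it, so no slack is left between `ψ₁`,
  -- `ψ₂` and their hulls.
  have heq := (s₁.half_add s₂).eq_of_le h.isSublinear hB hf h.mem_iff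
    (fun z hz => by linarith [z₁ z hz, z₂ z hz])
    (fun x => by linarith [le₁ x, le₂ x, hle x])
  have heq' : ∀ x, (1 / 2 : ℝ) * (g₁ x + g₂ x) = ψ x := fun x => congrFun heq x
  have e₁ : ψ₁ = g₁ := funext fun x => by linarith [le₁ x, le₂ x, hle x, heq' x]
  have e₂ : ψ₂ = g₂ := funext fun x => by linarith [le₁ x, le₂ x, hle x, heq' x]
  rw [e₁, e₂]
  exact ⟨fun x => by linarith [heq' x], ⟨s₁, z₁⟩, ⟨s₂, z₂⟩⟩

/-- With `D x` integral, subadditivity gives `1 ≤ n D g x + g (-f)` for every natural `n`, which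
fails for large `n` if `g x < 0`. -/
lemma IsSublinear.nonneg_of_isRationalVector {g : E q → ℝ} (hg : IsSublinear g)
    (hz : ∀ z ∈ integralPoints q, 1 ≤ g (z - f)) {x : E q} (hx : IsRationalVector x) :
    0 ≤ g x := by
  obtain ⟨D, hD, hDx⟩ := hx.exists_nat_smul
  by_contra! hneg
  have hD' : (1 : ℝ) ≤ D := by exact_mod_cast hD
  obtain ⟨n, hn⟩ := exists_nat_ge (g (-f) / (-g x))
  have h1 := hz _ (integralPoints_zsmul hDx n)
  rw [sub_eq_add_neg, smul_smul] at h1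
  have h2 := hg.add_le ((((n : ℤ) : ℝ) * D) • x) (-f)
  rw [Int.cast_natCast] at h1 h2
  rw [hg.smul_eq _ (by positivity)] at h2
  rw [div_le_iff₀ (by linarith)] at hn
  have h3 : (0 : ℝ) ≤ n * -g x := mul_nonneg (Nat.cast_nonneg n) (by linarith)
  nlinarith

lemma IsRationalVector.neg {x : E q} (hx : IsRationalVector x) : IsRationalVector (-x) := by
  intro i
  obtain ⟨c, hc⟩ := hx i
  exact ⟨-c, by simp [hc]⟩

lemma IsSublinear.le_zero_of_mem_of_basis {g : E q → ℝ} (hg : IsSublinear g)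
    {L : Submodule ℝ (E q)} {h : ℕ} (b : Module.Basis (Fin h) ℝ L)
    (hb : ∀ j, g (b j : E q) ≤ 0) (hb' : ∀ j, g (-(b j : E q)) ≤ 0) {l : E q} (hl : l ∈ L) :
    g l ≤ 0 := by
  have hsum := eq_sum_repr_coe b hl
  set c := b.repr ⟨l, hl⟩
  rw [hsum]
  refine (Finset.le_sum_of_subadditive g hg.zero.le hg.add_le _ _).trans
    (Finset.sum_nonpos fun j _ => ?_)
  rcases le_total 0 (c j) with hc | hc
  · rw [hg.smul_eq _ hc]
    exact mul_nonpos_of_nonneg_of_nonpos hc (hb j)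
  · rw [← neg_smul_neg, hg.smul_eq _ (neg_nonneg.2 hc)]
    exact mul_nonpos_of_nonneg_of_nonpos (neg_nonneg.2 hc) (hb' j)

variable {k h : ℕ} {v : Fin k → E q} {b : Module.Basis (Fin h) ℝ (lin B)}

lemma IsPsi.isExtreme_of_isExtreme_vertices (hψ : IsPsi f B ψ)
    (hB : IsMaximalLatticeFreeConvex B) (hf : f ∈ interior B)
    (hv : Set.range v = (orthSection f B).extremePoints ℝ)
    (hb : ∀ j, IsRationalVector (b j : E q))
    (H : IsExtreme (Rf f (Sum.elim (fun j => v j - f) (fun j => (b j : E q))))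
      (Sum.elim (fun _ : Fin k => (1 : ℝ)) (fun _ : Fin h => (0 : ℝ)))) :
    IsExtreme (RfAll f) ψ := by
  refine ⟨hψ.isSublinear.isValid (fun z hz => hψ.one_le hB hz) _, ?_⟩
  rintro ⟨ψ₁, ψ₂, hne, hv₁, hv₂, hle⟩
  obtain ⟨hadd, ⟨s₁, z₁⟩, ⟨s₂, z₂⟩⟩ := hψ.isSublinear_of_half_add_le hB hf hv₁ hv₂ hle
  have hlin : ∀ l ∈ lin B, ψ l = 0 := fun l hl =>
    hψ.isSublinear.eq_zero_of_mem_lin hB hf hψ.mem_iff hl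
  have hvert : ∀ j, ψ (v j - f) ≤ 1 := fun j => by
    have : v j ∈ (orthSection f B).extremePoints ℝ := hv ▸ Set.mem_range_self j
    exact (hψ.mem_iff _).1 this.1.1
  refine H.2 ⟨_, _, fun heq => hne ?_, s₁.isValid z₁ _, s₂.isValid z₂ _, ?_⟩
  · have hv12 : ∀ j, ψ₁ (v j - f) = ψ₂ (v j - f) := fun j => congrFun heq (Sum.inl j)
    -- On rational vectors of `lin B` both functions are nonnegative with sum `2 ψ x = 0`.
    have hzero : ∀ x : E q, x ∈ lin B → IsRationalVector x → ψ₁ x ≤ 0 ∧ ψ₂ x ≤ 0 :=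
      fun x hxL hx => by
        have h1 := s₁.nonneg_of_isRationalVector z₁ hx
        have h2 := s₂.nonneg_of_isRationalVector z₂ hx
        have h3 := hadd x
        rw [hlin x hxL] at h3
        constructor <;> linarith
    have hL₁ : ∀ l ∈ lin B, ψ₁ l ≤ 0 := fun l hl => s₁.le_zero_of_mem_of_basis b
      (fun j => (hzero _ (b j).2 (hb j)).1)
      (fun j => (hzero _ ((lin B).neg_mem (b j).2) (hb j).neg).1) hl
    have hL₂ : ∀ l ∈ lin B, ψ₂ l ≤ 0 := fun l hl => s₂.le_zero_of_mem_of_basis b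
      (fun j => (hzero _ (b j).2 (hb j)).2)
      (fun j => (hzero _ ((lin B).neg_mem (b j).2) (hb j).neg).2) hl
    funext x
    obtain ⟨c, hc, hcL, hsum⟩ := hψ.exists_combination hB hf hv x
    have hbound : ∀ g : E q → ℝ, IsSublinear g → (∀ l ∈ lin B, g l ≤ 0) →
        g x ≤ ∑ j, c j * g (v j - f) := fun g hg hgL => by
      have h1 := hg.add_le (∑ j, c j • (v j - f)) (x - ∑ j, c j • (v j - f))
      rw [add_sub_cancel] at h1
      linarith [hgL _ hcL, hg.sum_le Finset.univ c hc (fun j => v j - f)]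
    have h1 := hbound ψ₁ s₁ hL₁
    have h2 := hbound ψ₂ s₂ hL₂
    -- The upper bounds for `ψ₁ x` and `ψ₂ x` add up to at most `2 ψ x = ψ₁ x + ψ₂ x`, so both are
    -- tight; they are also equal to each other.
    have h3 : ∑ j, c j * ψ₁ (v j - f) + ∑ j, c j * ψ₂ (v j - f) ≤ 2 * ψ x := by
      rw [← hsum, ← Finset.sum_add_distrib, Finset.mul_sum]
      refine Finset.sum_le_sum fun j _ => ?_
      nlinarith [hc j, hadd (v j - f), hvert j, mul_nonneg (hc j) (sub_nonneg.2 (hvert j))]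
    have h4 : ∑ j, c j * ψ₁ (v j - f) = ∑ j, c j * ψ₂ (v j - f) :=
      Finset.sum_congr rfl fun j _ => by rw [hv12]
    linarith [hadd x]
  · rintro (j | j)
    · exact (hle _).trans (hvert j)
    · exact (hle _).trans (hlin _ (b j).2).le

/-- Raising the coefficient of `b j` by multiples of `D`, where `D • b j` is integral, preserves
feasibility, so a negative price would drive the left-hand side below `1`. -/
lemma IsPsi.nonneg_of_isValid_vertices (hψ : IsPsi f B ψ)
    (hB : IsMaximalLatticeFreeConvex B) (hf : f ∈ interior B)
    (hv : Set.range v = (orthSection f B).extremePoints ℝ)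
    (hb : ∀ j, IsRationalVector (b j : E q)) {φ : Fin k ⊕ Fin h → ℝ}
    (hφ : IsValid (Rf f (Sum.elim (fun j => v j - f) (fun j => (b j : E q)))) φ) (j : Fin h) :
    0 ≤ φ (Sum.inr j) := by
  classical
  rw [isValid_sumElim_iff] at hφ
  -- A feasible starting point: `-f` is represented by vertex directions modulo `lin B`, and the
  -- remainder by the basis up to an integral vector.
  obtain ⟨c, hc, hcL, -⟩ := hψ.exists_combination hB hf hv (-f)
  obtain ⟨w, hw, d, hd, hwd⟩ := exists_add_integral_eq_sum b hb hcL
  obtain ⟨D, hD, hDb⟩ := (hb j).exists_nat_smul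
  have hD' : (1 : ℝ) ≤ D := by exact_mod_cast hD
  by_contra! hneg
  set a := ∑ i, φ (Sum.inl i) * c i + ∑ i, φ (Sum.inr i) * d i with ha
  obtain ⟨n, hn⟩ := exists_nat_ge (a / (-φ (Sum.inr j)))
  set d' : Fin h → ℝ := d + Pi.single j ((n : ℝ) * D) with hd'
  have key := hφ c d' hc (fun i => by
    refine add_nonneg (hd i) ?_
    by_cases hij : i = j
    · subst hij
      rw [Pi.single_eq_same]
      positivity
    · rw [Pi.single_eq_of_ne hij]) (by
    have h1 : ∑ i, d' i • (b i : E q) =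
        ∑ i, d i • (b i : E q) + ((n : ℤ) : ℝ) • ((D : ℝ) • (b j : E q)) := by
      simp only [hd', Pi.add_apply, add_smul, Finset.sum_add_distrib]
      congr 1
      rw [Finset.sum_eq_single j (fun i _ hij => by simp [Pi.single_eq_of_ne hij]) (by simp),
        Pi.single_eq_same, mul_smul, Int.cast_natCast]
    have h2 : f + (∑ i, c i • (v i - f) +
        ∑ i, d' i • (b i : E q)) =
        w + ((n : ℤ) : ℝ) • ((D : ℝ) • (b j : E q)) := by
      rw [h1, ← hwd]
      abel
    rw [h2]
    exact integralPoints_add hw (integralPoints_zsmul hDb _))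
  have h3 : ∑ i, φ (Sum.inr i) * d' i =
      ∑ i, φ (Sum.inr i) * d i + φ (Sum.inr j) * (n * D) := by
    simp only [hd', Pi.add_apply, mul_add, Finset.sum_add_distrib]
    congr 1
    rw [Finset.sum_eq_single j (fun i _ hij => by simp [Pi.single_eq_of_ne hij]) (by simp),
      Pi.single_eq_same]
  rw [h3, ← add_assoc, ← ha] at key
  rw [div_le_iff₀ (by linarith)] at hn
  have h4 : (0 : ℝ) ≤ n * -φ (Sum.inr j) := mul_nonneg (Nat.cast_nonneg n) (by linarith)
  nlinarith

lemma IsPsi.isExtreme_vertices_of_isExtreme (hψ : IsPsi f B ψ)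
    (hB : IsMaximalLatticeFreeConvex B) (hf : f ∈ interior B)
    (hv : Set.range v = (orthSection f B).extremePoints ℝ)
    (hb : ∀ j, IsRationalVector (b j : E q)) (H : IsExtreme (RfAll f) ψ) :
    IsExtreme (Rf f (Sum.elim (fun j => v j - f) (fun j => (b j : E q))))
      (Sum.elim (fun _ : Fin k => (1 : ℝ)) (fun _ : Fin h => (0 : ℝ))) := by
  have hsub := hψ.isSublinear
  have hvmem : ∀ j, v j ∈ (orthSection f B).extremePoints ℝ := fun j =>
    hv ▸ Set.mem_range_self j
  constructor
  · have h1 := hsub.isValid (fun z hz => hψ.one_le hB hz)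
      (Sum.elim (fun j => v j - f) (fun j => (b j : E q)))
    rw [isValid_sumElim_iff] at h1 ⊢
    intro c d hc hd hmem
    refine (h1 c d hc hd hmem).trans (add_le_add ?_ ?_)
    · exact Finset.sum_le_sum fun j _ =>
        mul_le_mul_of_nonneg_right ((hψ.mem_iff _).1 (hvmem j).1.1) (hc j)
    · exact Finset.sum_le_sum fun j _ => mul_le_mul_of_nonneg_right
        (hsub.eq_zero_of_mem_lin hB hf hψ.mem_iff (b j).2).le (hd j)
  rintro ⟨φ₁, φ₂, hne, hv₁, hv₂, hle⟩
  have hle1 : ∀ j, (1 / 2 : ℝ) * (φ₁ (Sum.inl j) + φ₂ (Sum.inl j)) ≤ 1 := fun j => hle (Sum.inl j)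
  have hle0 : ∀ j, (1 / 2 : ℝ) * (φ₁ (Sum.inr j) + φ₂ (Sum.inr j)) ≤ 0 := fun j => hle (Sum.inr j)
  have nn₁ := hψ.nonneg_of_isValid_vertices hB hf hv hb hv₁
  have nn₂ := hψ.nonneg_of_isValid_vertices hB hf hv hb hv₂
  have zero₁ : ∀ j, φ₁ (Sum.inr j) = 0 := fun j => by linarith [nn₁ j, nn₂ j, hle0 j]
  have zero₂ : ∀ j, φ₂ (Sum.inr j) = 0 := fun j => by linarith [nn₁ j, nn₂ j, hle0 j]
  have hspan : ∀ x, ∃ s : Fin k →₀ ℝ, (∀ i, 0 ≤ s i) ∧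
      x - Finsupp.linearCombination ℝ (fun j => v j - f) s ∈ lin B := fun x => by
    obtain ⟨c, hc, hcL, -⟩ := hψ.exists_combination hB hf hv x
    refine ⟨Finsupp.equivFunOnFinite.symm c, hc, ?_⟩
    rw [Finsupp.linearCombination_apply, Finsupp.sum_fintype _ _ (by simp)]
    exact hcL
  have hvalid : ∀ {φ : Fin k ⊕ Fin h → ℝ},
      IsValid (Rf f (Sum.elim (fun j => v j - f) (fun j => (b j : E q)))) φ →
      (∀ j, φ (Sum.inr j) = 0) → ∀ s : Fin k →₀ ℝ, (∀ i, 0 ≤ s i) → ∀ z ∈ integralPoints q,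
        z - f - Finsupp.linearCombination ℝ (fun j => v j - f) s ∈ lin B →
        1 ≤ Finsupp.linearCombination ℝ (φ ∘ Sum.inl) s := by
    intro φ hφ h0 s hs z hz hL
    -- The remainder in `lin B` costs nothing: up to an integral shift it is a nonnegative
    -- combination of basis vectors of price zero.
    obtain ⟨w, hw, d, hd, hwd⟩ := exists_add_integral_eq_sum b hb hL
    rw [Finsupp.linearCombination_apply, Finsupp.sum_fintype _ _ (by simp)] at hwd ⊢
    have := isValid_sumElim_iff.1 hφ s d hs hd (by
      rw [← hwd]
      convert integralPoints_add hz hw using 1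
      abel)
    simpa [h0, mul_comm] using this
  have hull_le : ∀ {φ : Fin k ⊕ Fin h → ℝ},
      IsValid (Rf f (Sum.elim (fun j => v j - f) (fun j => (b j : E q)))) φ →
      (∀ j, φ (Sum.inr j) = 0) → ∀ (x : E q) (c : Fin k → ℝ), (∀ j, 0 ≤ c j) →
        x - ∑ j, c j • (v j - f) ∈ lin B →
        sublinearHull (φ ∘ Sum.inl) (fun j => v j - f) (lin B) x ≤
          ∑ j, c j * φ (Sum.inl j) := by
    intro φ hφ h0 x c hc hcL
    have := sublinearHull_le hspan (hvalid hφ h0) (x := x)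
      (s := Finsupp.equivFunOnFinite.symm c) hc (by
        rw [Finsupp.linearCombination_apply, Finsupp.sum_fintype _ _ (by simp)]
        exact hcL)
    rw [Finsupp.linearCombination_apply, Finsupp.sum_fintype _ _ (by simp)] at this
    exact this
  set g₁ := sublinearHull (φ₁ ∘ Sum.inl) (fun j => v j - f) (lin B) with hg₁
  set g₂ := sublinearHull (φ₂ ∘ Sum.inl) (fun j => v j - f) (lin B) with hg₂
  have s₁ : IsSublinear g₁ := isSublinear_sublinearHull hspan (hvalid hv₁ zero₁)
  have s₂ : IsSublinear g₂ := isSublinear_sublinearHull hspan (hvalid hv₂ zero₂)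
  have z₁ : ∀ z ∈ integralPoints q, 1 ≤ g₁ (z - f) := fun z hz =>
    one_le_sublinearHull hspan (hvalid hv₁ zero₁) hz
  have z₂ : ∀ z ∈ integralPoints q, 1 ≤ g₂ (z - f) := fun z hz =>
    one_le_sublinearHull hspan (hvalid hv₂ zero₂) hz
  have hgle : ∀ x, (1 / 2 : ℝ) * (g₁ x + g₂ x) ≤ ψ x := fun x => by
    obtain ⟨c, hc, hcL, hsum⟩ := hψ.exists_combination hB hf hv x
    have h1 := hull_le hv₁ zero₁ x c hc hcL
    have h2 := hull_le hv₂ zero₂ x c hc hcL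
    have h3 : ∑ j, c j * φ₁ (Sum.inl j) + ∑ j, c j * φ₂ (Sum.inl j) ≤ 2 * ψ x := by
      rw [← hsum, ← Finset.sum_add_distrib, Finset.mul_sum]
      refine Finset.sum_le_sum fun j _ => ?_
      nlinarith [mul_nonneg (hc j) (sub_nonneg.2 (hle1 j))]
    linarith
  have heq : ∀ x, (1 / 2 : ℝ) * (g₁ x + g₂ x) = ψ x :=
    congrFun ((s₁.half_add s₂).eq_of_le hsub hB hf hψ.mem_iff
      (fun z hz => by linarith [z₁ z hz, z₂ z hz]) hgle)
  refine H.2 ⟨g₁, g₂, fun hg => hne ?_, s₁.isValid z₁ _, s₂.isValid z₂ _, hgle⟩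
  funext i
  rcases i with j | j
  · have h1 : g₁ (v j - f) ≤ φ₁ (Sum.inl j) :=
      sublinearHull_apply_le hspan (hvalid hv₁ zero₁) j
    have h2 : g₂ (v j - f) ≤ φ₂ (Sum.inl j) :=
      sublinearHull_apply_le hspan (hvalid hv₂ zero₂) j
    -- The mean of the hulls at `v j - f` is `ψ (v j - f) ≥ 1`, while the mean of the prices is at
    -- most `1`; hence each hull attains its price.
    have h3 := hψ.one_le_of_mem_extremePoints hB hf (hvmem j)
    have h4 := congrFun hg (v j - f)
    linarith [heq (v j - f), hle1 j]
  · rw [zero₁, zero₂]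

end Extreme

end CornerRelaxation

theorem theorem5 (q : ℕ) (f : CornerRelaxation.E q) (B : Set (CornerRelaxation.E q))
    (hB : CornerRelaxation.IsMaximalLatticeFreeConvex B) (hf : f ∈ interior B) :
    B = CornerRelaxation.orthSection f B + (CornerRelaxation.lin B : Set (CornerRelaxation.E q)) ∧
    CornerRelaxation.IsRationalSpace (CornerRelaxation.lin B) ∧
    CornerRelaxation.IsPolytope (CornerRelaxation.orthSection f B) ∧
    (∃! ψ : CornerRelaxation.E q → ℝ, CornerRelaxation.IsPsi f B ψ) ∧
    ∀ (ψ : CornerRelaxation.E q → ℝ), CornerRelaxation.IsPsi f B ψ →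
      ∀ (k h : ℕ) (v : Fin k → CornerRelaxation.E q)
        (b : Module.Basis (Fin h) ℝ (CornerRelaxation.lin B)),
        Function.Injective v →
        Set.range v = (CornerRelaxation.orthSection f B).extremePoints ℝ →
        (∀ j, CornerRelaxation.IsRationalVector (b j : CornerRelaxation.E q)) →
        (CornerRelaxation.IsExtreme (CornerRelaxation.RfAll f) ψ ↔
          CornerRelaxation.IsExtreme
            (convexHull ℝ
              (CornerRelaxation.Rf f
                (Sum.elim (fun j : Fin k => v j - f)
                  (fun j : Fin h => (b j : CornerRelaxation.E q)))))
            (Sum.elim (fun _ : Fin k => (1 : ℝ)) (fun _ : Fin h => (0 : ℝ)))) := by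
  refine ⟨CornerRelaxation.eq_orthSection_add_lin f B, hB.isRationalSpace_lin hf,
    ⟨_, hB.finite_extremePoints_orthSection hf, hB.orthSection_eq_convexHull hf⟩,
    hB.existsUnique_isPsi hf, fun ψ hψ k h v b _ hv hb => ?_⟩
  rw [CornerRelaxation.isExtreme_convexHull_iff]
  exact ⟨hψ.isExtreme_vertices_of_isExtreme hB hf hv hb,
    hψ.isExtreme_of_isExtreme_vertices hB hf hv hb⟩
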